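/- **Setting.** A fusion center (FC) tracks a scalar process with correlation parameter $\alpha\in[0,1)$ using $N_S$ sensor nodes (SNs) that share $B$ orthogonal collision channels, $1\le B\le N_S$. An instruction assigns to each SN either idleness, or a channel in $\{1,\dots,B\}$ and a local measurement SNR $S_M\ge 0$; an active SN pays $c_{TX}+\phi S_M$ ($c_{TX}>0$, $\phi\ge 0$), an idle one pays $0$. If SN $n$ has accuracy state $\gamma_n$, the aggregate SNR is $\Lambda=\sum_n O_n\gamma_n^2\frac{S_AS_{M,n}}{S_A+S_{M,n}}$, where $S_A>0$ and $O_n=1$ iff SN $n$ is the only active SN in its channel. The prior variance $V_k$ ($V_0\in[0,1]$ given) and the posterior variance $\hat V_k$ satisfy $\hat V_k=\frac{V_k}{1+V_k\Lambda_k}$ and $V_{k+1}=1-\alpha(1-\hat V_k)$. For a horizon $T<\infty$, the MSE $\bar M$ is the expectation of $\frac1{T+1}\sum_{k=0}^T\hat V_k$ and the cost $\bar C^n$ of SN $n$ is its expected average cost over slots $0,\dots,T$; for $T=\infty$ these and the Lagrangian objective below are the $\limsup$ of the finite-horizon quantities. *Best-$\gamma$ scenario:* all $\gamma_{n,k}=\gamma_{\max}=1$.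 A coordinated policy draws the instruction in slot $k$ from a law $\delta_k(\cdot\mid V_k)$. Let $\delta^*$ be an optimal policy in this scenario, i.e. one that, among all coordinated policies, minimizes $\bar M$ subject to $\bar C^n\le\epsilon/N_S$ for all $n$ (for some $\epsilon>0$), or minimizes $\bar M+\frac{\lambda}{c_{TX}}\sum_n\bar C^n$ (for some $\lambda>0$), and that is of the following form: in slot $k$ it draws, given $V_k$, a number $t_k^*\in\{0,\dots,B\}$ and an SNR $S_{M,k}^*\ge0$, and activates $t_k^*$ SNs chosen uniformly at random, on distinct channels, all with SNR $S_{M,k}^*$. Let $\bar M^{\gamma_{\max}}_{\delta^*}$ and $\bar C^{n,\gamma_{\max}}_{\delta^*}$ be its MSE and costs. *Markov-$\gamma$ scenario:* the $\gamma_{n,k}$, $n=1,\dots,N_S$, are i.i.d. (across $n$) stationary Markov chains in a finite set $\Gamma\subset[0,1]$ with $\gamma_{\max}=\max\Gamma=1$, with any transition probabilities and a stationary law $\pi_\gamma$ with $\pi_\gamma(\gamma_{\max})>0$. *SCDP:* let $(t_k^*,S_{M,k}^*)_{k\ge0}$ be the random sequence generated by $\delta^*$ in the best-$\gamma$ scenario,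 independent of the accuracy states. In the Markov-$\gamma$ scenario, SCDP activates in slot $k$ the $t_k^*$ SNs of best rank, on distinct channels, with SNR $S_{M,k}^*$, where the SNs are ranked by decreasing $\gamma_{n,k}$, ties being broken by any (possibly randomized) rule that depends on the current accuracy states only. Let $\bar M_{\delta^*}$ and $\bar C^n_{\delta^*}$ be its MSE (with the true accuracy states) and costs, with the same horizon and the same $V_0$. **Theorem.** Suppose $N_S\ge\frac{B-1}{\pi_\gamma(\gamma_{\max})}$. For every finite horizon and for the infinite horizon: 1. The total cost $\sum_n\bar C^n$ (for the infinite horizon, the $\limsup$ of the finite-horizon totals) is the same under SCDP as under $\delta^*$ in the best-$\gamma$ scenario; and if ties are broken uniformly at random, $\bar C^n_{\delta^*}=\bar C^{n,\gamma_{\max}}_{\delta^*}$ for every SN $n$. 2. $$0\le\bar M_{\delta^*}-\bar M^{\gamma_{\max}}_{\delta^*}\le\frac1{1-\alpha}\exp\left\{-\frac{\left(N_S\pi_\gamma(\gamma_{\max})-B+1\right)^2}{2N_S\pi_\gamma(\gamma_{\max})}\right\}.$$ 3. In particular the gap decays exponentially in the network size: it is at most $\frac{e^{B-1}}{1-\alpha}\,e^{-N_S\pi_\gamma(\gamma_{\max})/2}$.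 -/

import Mathlib

open MeasureTheory ProbabilityTheory Filter
open scoped NNReal ENNReal

noncomputable section

namespace WSN

/-! ### Markov chains and horizons -/

/-- Law on `ℕ → X` of the (time-inhomogeneous) Markov chain with initial law `μ₀` and with
`κ k` as the transition kernel from slot `k` to slot `k + 1`. -/
def markovLaw {X : Type*} [MeasurableSpace X] (μ₀ : Measure X) (κ : ℕ → Kernel X X)
    [∀ k, IsMarkovKernel (κ k)] : Measure (ℕ → X) :=
  Kernel.trajMeasure (X := fun _ => X) μ₀
    (fun k => (κ k).comap (fun h => h ⟨k, Finset.mem_Iic.2 le_rfl⟩) (measurable_pi_apply _))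

/-- Value of a sequence of finite-horizon averages at the horizon `h`: the `T`-th term for a finite
horizon `T`, and the limit superior (long-term average) for the infinite horizon `⊤`. -/
def atHorizon {R : Type*} [ConditionallyCompleteLattice R] (h : ℕ∞) (f : ℕ → R) : R :=
  match h with
  | some T => f T
  | none => limsup f atTop

/-! ### Kalman filter -/

/-- Prior variance after the posterior variance `v`. -/
def nu (α v : ℝ) : ℝ := 1 - α * (1 - v)

/-- Posterior variance, given the prior variance `v` and the aggregate SNR `l`. -/
def nuHat (v l : ℝ) : ℝ := v / (1 + v * l)

/-- Posterior variance in slot `k`, from the prior variance `V0` in slot `0` and the aggregate SNR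
sequence `L`. -/
def postVar (α V0 : ℝ) (L : ℕ → ℝ) : ℕ → ℝ
  | 0 => nuHat V0 (L 0)
  | k + 1 => nuHat (nu α (postVar α V0 L k)) (L (k + 1))

/-- Sample average MSE over the slots `0, …, T`. -/
def sampleMSE (α V0 : ℝ) (L : ℕ → ℝ) (T : ℕ) : ℝ :=
  (1 / ((T : ℝ) + 1)) * ∑ k ∈ Finset.range (T + 1), postVar α V0 L k

/-! ### Instructions -/

/-- An instruction: for each of the `N` sensor nodes a channel index in `{0, 1, …, B}` and a local
measurement SNR. Channel `0` means that the node is idle, and then its SNR entry plays no role. -/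
abbrev Instr (N B : ℕ) : Type := Fin N → Fin (B + 1) × ℝ≥0

/-- The node `n` is activated. -/
def Active {N B : ℕ} (D : Instr N B) (n : Fin N) : Prop := (D n).1 ≠ 0

/-- Collision channel: the node `n` transmits, and no other node transmits in its channel. -/
def Success {N B : ℕ} (D : Instr N B) (n : Fin N) : Prop :=
  Active D n ∧ ∀ m, m ≠ n → (D m).1 ≠ (D n).1

open Classical in
/-- Aggregate SNR collected at the fusion center under the instruction `D` when the accuracy state
of node `n` is `g n`. -/
def aggSNR {N B : ℕ} (SA : ℝ) (g : Fin N → ℝ) (D : Instr N B) : ℝ :=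
  ∑ n, if Success D n then (g n) ^ 2 * (SA * (D n).2 / (SA + (D n).2)) else 0

open Classical in
/-- Sensing-transmission cost of node `n`. -/
def nodeCost {N B : ℕ} (cTX φ : ℝ) (n : Fin N) (D : Instr N B) : ℝ :=
  if Active D n then cTX + φ * (D n).2 else 0

/-- Sample average sensing-transmission cost of node `n` over the slots `0, …, T`. -/
def sampleCost {N B : ℕ} (cTX φ : ℝ) (n : Fin N) (D : ℕ → Instr N B) (T : ℕ) : ℝ :=
  (1 / ((T : ℝ) + 1)) * ∑ k ∈ Finset.range (T + 1), nodeCost cTX φ n (D k)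

open Classical in
/-- Number of activated nodes. -/
def numActive {N B : ℕ} (D : Instr N B) : ℕ := (Finset.univ.filter (Active D)).card

open Classical in
/-- Common local measurement SNR of the activated nodes (the largest one, should they differ; `0`
if no node is activated). -/
def commonSNR {N B : ℕ} (D : Instr N B) : ℝ≥0 :=
  (Finset.univ.filter (Active D)).sup (fun n => (D n).2)

instance instMeasurableSpacePerm (N : ℕ) : MeasurableSpace (Equiv.Perm (Fin N)) := ⊤

instance instDiscretePerm (N : ℕ) : DiscreteMeasurableSpace (Equiv.Perm (Fin N)) :=
  ⟨fun _ => trivial⟩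

/-- Activate the first `t` nodes (at most `B`) of the list `r 0, r 1, …`, all with local measurement
SNR `S`, on distinct channels; all other nodes are idle. -/
def schedule {N B : ℕ} (t : ℕ) (S : ℝ≥0) (r : Equiv.Perm (Fin N)) : Instr N B := fun n =>
  if h : ((r.symm n : Fin N) : ℕ) < t ∧ ((r.symm n : Fin N) : ℕ) < B then
    (⟨(r.symm n : Fin N) + 1, by omega⟩, S)
  else (0, 0)

/-! ### Coordinated policies in the scenario where every accuracy state is the best one -/

/-- A coordinated instruction policy: in slot `k`, given the prior variance, the instruction is drawn
from a probability law that may depend on `k`. -/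
structure Policy (N B : ℕ) where
  ker : ℕ → Kernel ℝ (Instr N B)
  markov : ∀ k, IsMarkovKernel (ker k)

instance instMarkovPolicy {N B : ℕ} (δ : Policy N B) (k : ℕ) : IsMarkovKernel (δ.ker k) :=
  δ.markov k

lemma measurable_aggSNR {N B : ℕ} (SA : ℝ) (g : Fin N → ℝ) :
    Measurable (aggSNR SA g : Instr N B → ℝ) := by
  classical
  unfold aggSNR
  refine Finset.measurable_sum _ fun n _ => Measurable.ite ?_ (by fun_prop) measurable_const
  have hc : Measurable (fun D : Instr N B => fun m => (D m).1) := by fun_prop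
  exact hc (Set.toFinite {c : Fin N → Fin (B + 1) |
    c n ≠ 0 ∧ ∀ m, m ≠ n → c m ≠ c n}).measurableSet

/-- Aggregate SNR when every node has the best accuracy state `1`. -/
def bestSNR {N B : ℕ} (SA : ℝ) (D : Instr N B) : ℝ := aggSNR SA (fun _ => 1) D

lemma measurable_nextPrior {N B : ℕ} (α SA : ℝ) :
    Measurable (fun s : ℝ × Instr N B => nu α (nuHat s.1 (bestSNR SA s.2))) := by
  have : Measurable (fun s : ℝ × Instr N B => aggSNR SA (fun _ => 1) s.2) :=
    (measurable_aggSNR SA _).comp measurable_snd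
  unfold nu nuHat bestSNR
  fun_prop

/-- Law of the sequence `(V_k, D_k)` of prior variances and instructions generated by the policy `δ`
when every node has the best accuracy state: `V_0 = V0`, `D_k` has law `δ_k(· | V_k)`, and
`V_{k+1} = ν(ν̂(V_k, Λ_k))`. -/
def policyLaw {N B : ℕ} (α SA V0 : ℝ) (δ : Policy N B) : Measure (ℕ → ℝ × Instr N B) :=
  markovLaw ((Kernel.id ×ₖ δ.ker 0) V0)
    (fun k => (Kernel.id ×ₖ δ.ker (k + 1)).comap
      (fun s : ℝ × Instr N B => nu α (nuHat s.1 (bestSNR SA s.2))) (measurable_nextPrior α SA))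

/-- Average MSE over the slots `0, …, T` for a random aggregate SNR sequence `L`. -/
def avgMSE {Ω : Type*} [MeasurableSpace Ω] (α V0 : ℝ) (μ : Measure Ω) (L : Ω → ℕ → ℝ) (T : ℕ) : ℝ :=
  ∫ ω, sampleMSE α V0 (L ω) T ∂μ

/-- Average cost of node `n` over the slots `0, …, T` for a random sequence `D` of instructions. -/
def avgCost {Ω : Type*} [MeasurableSpace Ω] {N B : ℕ} (cTX φ : ℝ) (n : Fin N) (μ : Measure Ω)
    (D : Ω → ℕ → Instr N B) (T : ℕ) : ℝ≥0∞ :=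
  ∫⁻ ω, ENNReal.ofReal (sampleCost cTX φ n (D ω) T) ∂μ

/-- Average MSE over `0, …, T` of the policy `δ` when every accuracy state is the best one. -/
def bestMSE {N B : ℕ} (α SA V0 : ℝ) (δ : Policy N B) (T : ℕ) : ℝ :=
  avgMSE α V0 (policyLaw α SA V0 δ) (fun ω k => bestSNR SA (ω k).2) T

/-- Average cost of node `n` over `0, …, T` under the policy `δ` when every accuracy state is the
best one. -/
def bestCost {N B : ℕ} (α SA V0 cTX φ : ℝ) (δ : Policy N B) (n : Fin N) (T : ℕ) : ℝ≥0∞ :=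
  avgCost cTX φ n (policyLaw α SA V0 δ) (fun ω k => (ω k).2) T

/-- Every node satisfies the average cost constraint `ε / N`. -/
def Feasible {N B : ℕ} (α SA V0 cTX φ ε : ℝ) (h : ℕ∞) (δ : Policy N B) : Prop :=
  ∀ n, atHorizon h (bestCost α SA V0 cTX φ δ n) ≤ ENNReal.ofReal (ε / N)

/-- `δ` minimizes the average MSE among all coordinated policies that satisfy the cost constraint. -/
def SolvesConstrained {N B : ℕ} (α SA V0 cTX φ ε : ℝ) (h : ℕ∞) (δ : Policy N B) : Prop :=
  Feasible α SA V0 cTX φ ε h δ ∧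
    ∀ δ' : Policy N B, Feasible α SA V0 cTX φ ε h δ' →
      atHorizon h (bestMSE α SA V0 δ) ≤ atHorizon h (bestMSE α SA V0 δ')

/-- Average MSE plus `lam / cTX` times the total average cost. -/
def lagrangian {N B : ℕ} (α SA V0 cTX φ lam : ℝ) (δ : Policy N B) (T : ℕ) : ℝ≥0∞ :=
  ENNReal.ofReal (bestMSE α SA V0 δ T) +
    ENNReal.ofReal (lam / cTX) * ∑ n, bestCost α SA V0 cTX φ δ n T

/-- `δ` minimizes the Lagrangian objective among all coordinated policies. -/
def SolvesLagrangian {N B : ℕ} (α SA V0 cTX φ lam : ℝ) (h : ℕ∞) (δ : Policy N B) : Prop :=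
  ∀ δ' : Policy N B, atHorizon h (lagrangian α SA V0 cTX φ lam δ) ≤
    atHorizon h (lagrangian α SA V0 cTX φ lam δ')

/-! ### Policies that choose a number of nodes and a common SNR -/

/-- A rule that draws, in slot `k` and given the prior variance, the number `t_k ∈ {0, …, B}` of nodes
to activate and their common local measurement SNR. -/
structure Rule (B : ℕ) where
  ker : ℕ → Kernel ℝ (Fin (B + 1) × ℝ≥0)
  markov : ∀ k, IsMarkovKernel (ker k)

instance instMarkovRule {B : ℕ} (δ : Rule B) (k : ℕ) : IsMarkovKernel (δ.ker k) := δ.markov k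

lemma measurable_schedule {N B : ℕ} : Measurable
    (fun p : (Fin (B + 1) × ℝ≥0) × Equiv.Perm (Fin N) =>
      (schedule (p.1.1 : ℕ) p.1.2 p.2 : Instr N B)) := by
  have h1 : ∀ q : Fin (B + 1) × Equiv.Perm (Fin N),
      Measurable (fun S : ℝ≥0 => (schedule (q.1 : ℕ) S q.2 : Instr N B)) := by
    intro q
    refine measurable_pi_lambda _ fun n => ?_
    unfold schedule
    split_ifs <;> fun_prop
  have h2 : Measurable (fun p : (Fin (B + 1) × Equiv.Perm (Fin N)) × ℝ≥0 =>
      (schedule (p.1.1 : ℕ) p.2 p.1.2 : Instr N B)) :=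
    measurable_from_prod_countable_right h1
  exact h2.comp (f := fun p : (Fin (B + 1) × ℝ≥0) × Equiv.Perm (Fin N) => ((p.1.1, p.2), p.1.2))
    (by fun_prop)

/-- The coordinated policy that draws `(t_k, S_k)` from the rule, and activates `t_k` nodes, chosen
uniformly at random, with the common local measurement SNR `S_k`, on distinct channels. -/
def Rule.toPolicy {B : ℕ} (N : ℕ) (δ : Rule B) : Policy N B where
  ker k := ((δ.ker k) ×ₖ
    Kernel.const ℝ (PMF.uniformOfFintype (Equiv.Perm (Fin N))).toMeasure).map
      (fun p => schedule (p.1.1 : ℕ) p.1.2 p.2)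
  markov _ := Kernel.IsMarkovKernel.map _ measurable_schedule

/-! ### Markovian accuracy states, rankings, and the sub-optimal coordinated policy -/

/-- `r` lists the nodes in order of decreasing accuracy state. -/
def IsRanking {N : ℕ} {Γ : Finset ℝ} (γ : Fin N → Γ) (r : Equiv.Perm (Fin N)) : Prop :=
  Antitone (fun m => ((γ (r m) : Γ) : ℝ))

/-- A (possibly randomized) ranking of the nodes as a function of their accuracy states. -/
def IsRankingRule {N : ℕ} {Γ : Finset ℝ} (ρ : (Fin N → Γ) → PMF (Equiv.Perm (Fin N))) : Prop :=
  ∀ γ, ∀ r ∈ (ρ γ).support, IsRanking γ r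

lemma exists_isRanking {N : ℕ} {Γ : Finset ℝ} (γ : Fin N → Γ) : ∃ r, IsRanking γ r := by
  refine ⟨Tuple.sort (fun n => -((γ n : Γ) : ℝ)), fun a b hab => ?_⟩
  have := Tuple.monotone_sort (fun n => -((γ n : Γ) : ℝ)) hab
  simp only [Function.comp_def] at this
  exact neg_le_neg_iff.1 this

open Classical in
/-- The ranking in which ties are broken uniformly at random. -/
def uniformRanking {N : ℕ} {Γ : Finset ℝ} (γ : Fin N → Γ) : PMF (Equiv.Perm (Fin N)) :=
  PMF.uniformOfFinset (Finset.univ.filter (IsRanking γ)) (by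
    obtain ⟨r, hr⟩ := exists_isRanking γ
    exact ⟨r, by simpa using hr⟩)

/-- One step of the vector of accuracy states: the nodes move independently, each with the transition
probabilities `P`. -/
def accuracyStep {N : ℕ} {Γ : Finset ℝ} (P : Γ → PMF Γ) : Kernel (Fin N → Γ) (Fin N → Γ) :=
  Kernel.ofFunOfCountable fun γ => Measure.pi fun n => (P (γ n)).toMeasure

instance instMarkovAccuracyStep {N : ℕ} {Γ : Finset ℝ} (P : Γ → PMF Γ) :
    IsMarkovKernel (accuracyStep (N := N) P) :=
  ⟨fun γ => inferInstanceAs (IsProbabilityMeasure (Measure.pi fun n => (P (γ n)).toMeasure))⟩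

/-- The ranking drawn from the accuracy states. -/
def rankKernel {N : ℕ} {Γ : Finset ℝ} (ρ : (Fin N → Γ) → PMF (Equiv.Perm (Fin N))) :
    Kernel (Fin N → Γ) (Equiv.Perm (Fin N)) :=
  Kernel.ofFunOfCountable fun γ => (ρ γ).toMeasure

instance instMarkovRankKernel {N : ℕ} {Γ : Finset ℝ}
    (ρ : (Fin N → Γ) → PMF (Equiv.Perm (Fin N))) : IsMarkovKernel (rankKernel ρ) :=
  ⟨fun γ => inferInstanceAs (IsProbabilityMeasure (ρ γ).toMeasure)⟩

/-- Law of the sequence `(γ_k, r_k)` of accuracy states and rankings: the accuracy states of the nodes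
are independent Markov chains with initial law `π` and transition probabilities `P`, and `r_k` is drawn
from `ρ (γ_k)`. -/
def sensorLaw {N : ℕ} {Γ : Finset ℝ} (π : PMF Γ) (P : Γ → PMF Γ)
    (ρ : (Fin N → Γ) → PMF (Equiv.Perm (Fin N))) :
    Measure (ℕ → (Fin N → Γ) × Equiv.Perm (Fin N)) :=
  markovLaw ((Kernel.id ×ₖ rankKernel ρ) ∘ₘ Measure.pi (fun _ : Fin N => π.toMeasure))
    (fun _ => ((Kernel.id ×ₖ rankKernel ρ) ∘ₖ accuracyStep P).comap Prod.fst measurable_fst)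

/-- Sample space of the sub-optimal coordinated policy: the virtual prior variances `Ṽ_k` and the
instructions `D_k*` generated by `δ*` as if all accuracy states were the best one; and the accuracy
states and rankings of the nodes. -/
abbrev JointPath (N B : ℕ) (Γ : Finset ℝ) : Type :=
  (ℕ → ℝ × Instr N B) × (ℕ → (Fin N → Γ) × Equiv.Perm (Fin N))

/-- The virtual process driven by `δ` and the accuracy states are independent. -/
def jointLaw {N B : ℕ} {Γ : Finset ℝ} (α SA V0 : ℝ) (δ : Policy N B) (π : PMF Γ) (P : Γ → PMF Γ)
    (ρ : (Fin N → Γ) → PMF (Equiv.Perm (Fin N))) : Measure (JointPath N B Γ) :=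
  (policyLaw α SA V0 δ).prod (sensorLaw π P ρ)

/-- The sub-optimal coordinated policy: in slot `k`, the `t_k*` nodes of best rank are activated with
local measurement SNR `S_k*`, where `t_k*` and `S_k*` are the number of active nodes and the common
SNR of the instruction `D_k*`. -/
def scdpInstr {N B : ℕ} {Γ : Finset ℝ} (ω : JointPath N B Γ) (k : ℕ) : Instr N B :=
  schedule (numActive (ω.1 k).2) (commonSNR (ω.1 k).2) (ω.2 k).2

/-- Aggregate SNR collected under the sub-optimal coordinated policy, with the true accuracy states. -/
def scdpSNR {N B : ℕ} {Γ : Finset ℝ} (SA : ℝ) (ω : JointPath N B Γ) (k : ℕ) : ℝ :=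
  aggSNR SA (fun n => (((ω.2 k).1 n : Γ) : ℝ)) (scdpInstr ω k)

/-- Average MSE of the sub-optimal coordinated policy over `0, …, T`. -/
def scdpMSE {N B : ℕ} {Γ : Finset ℝ} (α SA V0 : ℝ) (δ : Policy N B) (π : PMF Γ) (P : Γ → PMF Γ)
    (ρ : (Fin N → Γ) → PMF (Equiv.Perm (Fin N))) (T : ℕ) : ℝ :=
  avgMSE α V0 (jointLaw α SA V0 δ π P ρ) (scdpSNR SA) T

/-- Average cost of node `n` over `0, …, T` under the sub-optimal coordinated policy. -/
def scdpCost {N B : ℕ} {Γ : Finset ℝ} (α SA V0 cTX φ : ℝ) (δ : Policy N B) (π : PMF Γ)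
    (P : Γ → PMF Γ) (ρ : (Fin N → Γ) → PMF (Equiv.Perm (Fin N))) (n : Fin N) (T : ℕ) : ℝ≥0∞ :=
  avgCost cTX φ n (jointLaw α SA V0 δ π P ρ) scdpInstr T

end WSN

end

noncomputable section

namespace WSN

/-! ### Marginals of a Markov chain -/

section Markov

variable {X : Type*} [MeasurableSpace X] (μ₀ : Measure X) [IsProbabilityMeasure μ₀]
  (κ : ℕ → Kernel X X) [∀ k, IsMarkovKernel (κ k)]

/-! Run SCDP and the best-`γ` process on one probability space, driven by the same sequence `(t_k,
S_k)`. Since `t_k ≤ B`, in a slot with at least `B` nodes in state `1` every scheduled node has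
accuracy `1` and the two aggregate SNRs coincide; in any other slot the SNR of SCDP is at most the
virtual one.

The Kalman recursion turns this into a bound on the MSE gap. `nuHat` increases with the prior
variance and decreases with the SNR, so the gap is nonnegative. `nuHat` is also 1-Lipschitz in the
prior variance and `nu` has slope `α`, so the gap `Δ` satisfies `Δ_{k+1} ≤ α Δ_k + 1{fewer than B
nodes in state 1}` (`postVar_succ_sub_le`). By stationarity the indicator has the same mean `q` in
every slot, and the expected gap stays below `q / (1 - α)` (`integral_gap_mem`). Finally `q` is a
lower binomial tail, bounded by Chernoff's method (`measureReal_numBest_lt_le`).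

The total cost of a slot depends only on `(t_k, S_k)`, hence is the same for both processes. With
uniform tie-breaking both scenarios are symmetric in the nodes, so equal totals give equal
individual costs (`scdpCost_eq_bestCost`). -/

instance instProbMarkovLaw : IsProbabilityMeasure (markovLaw μ₀ κ) := by
  unfold markovLaw; infer_instance

omit [IsProbabilityMeasure μ₀] in
lemma map_zero_markovLaw : (markovLaw μ₀ κ).map (fun ω => ω 0) = μ₀ := by
  unfold markovLaw Kernel.trajMeasure
  have h0 : (fun ω : ℕ → X => ω 0) =
      (fun x : (Finset.Iic 0 → X) => x ⟨0, Finset.mem_Iic.2 le_rfl⟩) ∘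
        Preorder.frestrictLe (π := fun _ : ℕ => X) 0 := rfl
  rw [h0, ← Measure.map_map (by fun_prop) (by fun_prop), Measure.map_comp _ _ (by fun_prop),
    Kernel.traj_map_frestrictLe, Kernel.partialTraj_self, Measure.id_comp,
    Measure.map_map (by fun_prop) (by fun_prop)]
  exact Measure.map_id

/-- The trajectory measure uses kernels on whole histories. Here each kernel reads only the last
coordinate, so the history can be projected away. Expectations are additive over slots, so these
one-slot marginals are enough for everything below. -/
lemma map_succ_markovLaw (k : ℕ) :
    (markovLaw μ₀ κ).map (fun ω => ω (k + 1)) = κ k ∘ₘ (markovLaw μ₀ κ).map (fun ω => ω k) := by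
  have key := Kernel.map_frestrictLe_trajMeasure_compProd_eq_map_trajMeasure (X := fun _ => X)
    (μ₀ := μ₀) (a := k)
    (κ := fun k => (κ k).comap (fun h : Finset.Iic k → X => h ⟨k, Finset.mem_Iic.2 le_rfl⟩)
      (measurable_pi_apply _))
  change (markovLaw μ₀ κ).map _ ⊗ₘ _ = (markovLaw μ₀ κ).map _ at key
  have h1 := congrArg Measure.snd key
  rw [Measure.snd_compProd, Measure.snd, Measure.map_map (by fun_prop) (by fun_prop)] at h1
  have h2 : (fun ω : ℕ → X => ω k) =
      (fun x : (Finset.Iic k → X) => x ⟨k, Finset.mem_Iic.2 le_rfl⟩) ∘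
        Preorder.frestrictLe (π := fun _ : ℕ => X) k := rfl
  refine h1.symm.trans ?_
  rw [h2, ← Measure.map_map (by fun_prop) (by fun_prop)]
  generalize (markovLaw μ₀ κ).map (Preorder.frestrictLe k) = ν
  rw [← Measure.deterministic_comp_eq_map (by fun_prop), Measure.comp_assoc,
    Kernel.comp_deterministic_eq_comap]

end Markov

/-! ### Kalman filter -/

lemma nuHat_nonneg {v l : ℝ} (hv : 0 ≤ v) (hl : 0 ≤ l) : 0 ≤ nuHat v l := by
  unfold nuHat; positivity

lemma nuHat_le_self {v l : ℝ} (hv : 0 ≤ v) (hl : 0 ≤ l) : nuHat v l ≤ v := by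
  unfold nuHat
  exact div_le_self hv (by nlinarith [mul_nonneg hv hl])

/-- After clearing denominators the claim is `0 ≤ v' - v + v * v' * (l - l')`. -/
lemma nuHat_mono {v v' l l' : ℝ} (hv : 0 ≤ v) (hvv : v ≤ v') (hl : 0 ≤ l') (hll : l' ≤ l) :
    nuHat v l ≤ nuHat v' l' := by
  unfold nuHat
  have hv' := hv.trans hvv
  have hl' := hl.trans hll
  rw [div_le_div_iff₀ (by positivity) (by positivity)]
  nlinarith [mul_le_mul_of_nonneg_left hll (mul_nonneg hv hv')]

/-- The difference is `v' - v` divided by two factors that are both at least `1`. -/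
lemma nuHat_sub_le {v v' l : ℝ} (hv : 0 ≤ v) (hvv : v ≤ v') (hl : 0 ≤ l) :
    nuHat v' l - nuHat v l ≤ v' - v := by
  unfold nuHat
  have hv' := hv.trans hvv
  have h1 : v' / (1 + v' * l) - v / (1 + v * l) = (v' - v) / ((1 + v' * l) * (1 + v * l)) := by
    have : 1 + v' * l ≠ 0 := by positivity
    have : 1 + v * l ≠ 0 := by positivity
    field_simp
    ring
  rw [h1]
  refine div_le_self (by linarith) ?_
  nlinarith [mul_nonneg hv hl, mul_nonneg hv' hl, mul_nonneg (mul_nonneg hv hl) (mul_nonneg hv' hl)]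

lemma nu_mem {α v : ℝ} (hα0 : 0 ≤ α) (hα1 : α ≤ 1) (hv0 : 0 ≤ v) (hv1 : v ≤ 1) :
    0 ≤ nu α v ∧ nu α v ≤ 1 := by
  unfold nu
  constructor <;> nlinarith [mul_nonneg hα0 hv0, mul_nonneg hα0 (sub_nonneg.2 hv1)]

section PostVar

variable {α V0 : ℝ} (hα0 : 0 ≤ α) (hα1 : α ≤ 1) (hV0 : 0 ≤ V0) (hV1 : V0 ≤ 1)
include hα0 hα1 hV0 hV1

lemma postVar_mem {L : ℕ → ℝ} (hL : ∀ k, 0 ≤ L k) (k : ℕ) :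
    0 ≤ postVar α V0 L k ∧ postVar α V0 L k ≤ 1 := by
  induction k with
  | zero => exact ⟨nuHat_nonneg hV0 (hL 0), (nuHat_le_self hV0 (hL 0)).trans hV1⟩
  | succ k ih =>
    obtain ⟨h0, h1⟩ := nu_mem hα0 hα1 ih.1 ih.2
    exact ⟨nuHat_nonneg h0 (hL _), (nuHat_le_self h0 (hL _)).trans h1⟩

lemma postVar_le {L L' : ℕ → ℝ} (hL' : ∀ k, 0 ≤ L' k) (hLL : ∀ k, L' k ≤ L k) (k : ℕ) :
    postVar α V0 L k ≤ postVar α V0 L' k := by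
  induction k with
  | zero => exact nuHat_mono hV0 le_rfl (hL' 0) (hLL 0)
  | succ k ih =>
    have hL := fun k => (hL' k).trans (hLL k)
    have hm := postVar_mem hα0 hα1 hV0 hV1 hL k
    refine nuHat_mono (nu_mem hα0 hα1 hm.1 hm.2).1 ?_ (hL' _) (hLL _)
    unfold nu
    nlinarith

/-- The gap between the posterior variances contracts in a slot in which the aggregate SNRs agree. -/
lemma postVar_succ_sub_le {L L' : ℕ → ℝ} (hL' : ∀ k, 0 ≤ L' k) (hLL : ∀ k, L' k ≤ L k) (k : ℕ)
    {b : ℝ} (hb0 : 0 ≤ b) (hb : b < 1 → L' (k + 1) = L (k + 1)) :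
    postVar α V0 L' (k + 1) - postVar α V0 L (k + 1) ≤
      α * (postVar α V0 L' k - postVar α V0 L k) + b := by
  have hL := fun k => (hL' k).trans (hLL k)
  have hle := postVar_le hα0 hα1 hV0 hV1 hL' hLL k
  have hm := postVar_mem hα0 hα1 hV0 hV1 hL k
  -- `b` plays the indicator of a bad slot. If `b < 1` the SNRs agree and only the gap of the priors
  -- remains, which `nu` has scaled by `α`. Otherwise the bound holds because posterior variances
  -- lie in `[0, 1]`.
  rcases lt_or_ge b 1 with h | h
  · have hnn : nu α (postVar α V0 L k) ≤ nu α (postVar α V0 L' k) := by unfold nu; nlinarith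
    have := nuHat_sub_le (nu_mem hα0 hα1 hm.1 hm.2).1 hnn (hL (k + 1))
    simp only [postVar]
    rw [hb h]
    unfold nu at this ⊢
    linarith
  · have h1 := (postVar_mem hα0 hα1 hV0 hV1 hL' (k + 1)).2
    have h2 := (postVar_mem hα0 hα1 hV0 hV1 hL (k + 1)).1
    have := mul_nonneg hα0 (sub_nonneg.2 hle)
    linarith

/-- Both filters start from the same prior `V0`, so there is no earlier gap to propagate. -/
lemma postVar_zero_sub_le {L L' : ℕ → ℝ} (hL' : ∀ k, 0 ≤ L' k) (hLL : ∀ k, L' k ≤ L k)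
    {b : ℝ} (hb0 : 0 ≤ b) (hb : b < 1 → L' 0 = L 0) :
    postVar α V0 L' 0 - postVar α V0 L 0 ≤ b := by
  have hL := fun k => (hL' k).trans (hLL k)
  rcases lt_or_ge b 1 with h | h
  · simp only [postVar, hb h, sub_self, hb0]
  · have h1 := (postVar_mem hα0 hα1 hV0 hV1 hL' 0).2
    have h2 := (postVar_mem hα0 hα1 hV0 hV1 hL 0).1
    linarith

end PostVar

lemma measurable_postVar {Ω : Type*} [MeasurableSpace Ω] (α V0 : ℝ) {L : Ω → ℕ → ℝ}
    (hL : ∀ k, Measurable fun ω => L ω k) (k : ℕ) : Measurable fun ω => postVar α V0 (L ω) k := by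
  induction k with
  | zero => simp only [postVar, nuHat]; fun_prop
  | succ k ih => simp only [postVar, nuHat, nu]; fun_prop

/-! ### Instructions that activate a list of nodes -/

section Schedule

variable {N B : ℕ} {t : ℕ} (S : ℝ≥0) (r : Equiv.Perm (Fin N)) (htB : t ≤ B)
include htB

lemma active_schedule_iff (n : Fin N) :
    Active (schedule t S r : Instr N B) n ↔ ((r.symm n : Fin N) : ℕ) < t := by
  unfold Active schedule
  split_ifs with h
  · simp [h.1, Fin.ext_iff]
  · have : ¬ ((r.symm n : Fin N) : ℕ) < t := fun h' => h ⟨h', h'.trans_le htB⟩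
    simp [this]

lemma schedule_snr {n : Fin N} (hn : ((r.symm n : Fin N) : ℕ) < t) :
    ((schedule t S r : Instr N B) n).2 = S := by
  unfold schedule
  rw [dif_pos ⟨hn, hn.trans_le htB⟩]

/-- The node at position `i` of the list uses channel `i + 1`, so active nodes never collide; idle
nodes are on channel `0`. -/
lemma success_schedule_iff (n : Fin N) :
    Success (schedule t S r : Instr N B) n ↔ ((r.symm n : Fin N) : ℕ) < t := by
  unfold Success
  rw [active_schedule_iff S r htB, and_iff_left_iff_imp]
  intro hn m hmn
  unfold schedule
  rw [dif_pos (⟨hn, hn.trans_le htB⟩ : _ ∧ _)]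
  split_ifs with h
  · simp only [ne_eq, Fin.mk.injEq, Nat.add_right_cancel_iff]
    exact fun h' => hmn (r.symm.injective (Fin.ext h'))
  · simp [Fin.ext_iff]

lemma aggSNR_schedule (SA : ℝ) (g : Fin N → ℝ) :
    aggSNR SA g (schedule t S r : Instr N B) =
      ∑ i : Fin N, if (i : ℕ) < t then (g (r i)) ^ 2 * (SA * S / (SA + S)) else 0 := by
  unfold aggSNR
  rw [← Equiv.sum_comp r]
  refine Finset.sum_congr rfl fun i _ => ?_
  simp only [success_schedule_iff S r htB, Equiv.symm_apply_apply]
  split_ifs with h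
  · rw [schedule_snr S r htB (by simpa using h)]
  · rfl

lemma nodeCost_schedule (cTX φ : ℝ) (n : Fin N) :
    nodeCost cTX φ n (schedule t S r : Instr N B) =
      if ((r.symm n : Fin N) : ℕ) < t then cTX + φ * S else 0 := by
  unfold nodeCost
  simp only [active_schedule_iff S r htB]
  split_ifs with h
  · rw [schedule_snr S r htB h]
  · rfl

omit htB in
lemma card_filter_val_lt {t : ℕ} (htN : t ≤ N) :
    (Finset.univ.filter fun i : Fin N => (i : ℕ) < t).card = t := by
  rw [Fin.card_filter_val_lt, min_eq_right htN]

variable (htN : t ≤ N)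
include htN

lemma sum_nodeCost_schedule (cTX φ : ℝ) :
    ∑ n, nodeCost cTX φ n (schedule t S r : Instr N B) = t * (cTX + φ * S) := by
  simp only [nodeCost_schedule S r htB]
  rw [← Equiv.sum_comp r]
  simp only [Equiv.symm_apply_apply, ← Finset.sum_filter, Finset.sum_const, nsmul_eq_mul,
    card_filter_val_lt htN]

lemma bestSNR_schedule (SA : ℝ) :
    bestSNR SA (schedule t S r : Instr N B) = t * (SA * S / (SA + S)) := by
  unfold bestSNR
  rw [aggSNR_schedule S r htB]
  simp only [one_pow, one_mul, ← Finset.sum_filter, Finset.sum_const, nsmul_eq_mul,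
    card_filter_val_lt htN]

lemma aggSNR_schedule_le {SA : ℝ} (hSA : 0 < SA) {g : Fin N → ℝ} (hg0 : ∀ n, 0 ≤ g n)
    (hg1 : ∀ n, g n ≤ 1) :
    aggSNR SA g (schedule t S r : Instr N B) ≤ t * (SA * S / (SA + S)) := by
  rw [← bestSNR_schedule S r htB htN, bestSNR, aggSNR_schedule S r htB, aggSNR_schedule S r htB]
  refine Finset.sum_le_sum fun i _ => ?_
  split_ifs
  · exact mul_le_mul_of_nonneg_right ((pow_le_one₀ (hg0 _) (hg1 _)).trans_eq (one_pow 2).symm) (by positivity)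
  · exact le_rfl

lemma aggSNR_schedule_eq (SA : ℝ) {g : Fin N → ℝ} (hg : ∀ i : Fin N, (i : ℕ) < t → g (r i) = 1) :
    aggSNR SA g (schedule t S r : Instr N B) = t * (SA * S / (SA + S)) := by
  rw [← bestSNR_schedule S r htB htN, bestSNR, aggSNR_schedule S r htB, aggSNR_schedule S r htB]
  refine Finset.sum_congr rfl fun i _ => ?_
  split_ifs with h
  · rw [hg i h]
  · rfl

/-- `scdpInstr` reads `(t, S)` back from the drawn instruction; this lemma and `commonSNR_schedule`
show that nothing relevant is lost. -/
lemma numActive_schedule : numActive (schedule t S r : Instr N B) = t := by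
  unfold numActive
  simp only [active_schedule_iff S r htB]
  conv_rhs => rw [← card_filter_val_lt htN]
  exact Finset.card_equiv r.symm (by simp)

/-- For `t = 0` the supremum is empty and returns `0` instead of `S`, hence the assumption `ht`. -/
lemma commonSNR_schedule (ht : 0 < t) : commonSNR (schedule t S r : Instr N B) = S := by
  unfold commonSNR
  simp only [active_schedule_iff S r htB]
  refine le_antisymm (Finset.sup_le fun n hn => ?_) ?_
  · rw [schedule_snr S r htB (by simpa using hn)]
  · have hN : 0 < N := ht.trans_le htN
    have hn : ((r.symm (r ⟨0, hN⟩) : Fin N) : ℕ) < t := by simpa using ht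
    refine le_trans ?_ (Finset.le_sup (b := r ⟨0, hN⟩) (by simpa using ht))
    rw [schedule_snr S r htB hn]

end Schedule

lemma aggSNR_nonneg {N B : ℕ} {SA : ℝ} (hSA : 0 < SA) (g : Fin N → ℝ) (D : Instr N B) :
    0 ≤ aggSNR SA g D := by
  unfold aggSNR
  refine Finset.sum_nonneg fun n _ => ?_
  split_ifs
  · positivity
  · exact le_rfl

lemma nodeCost_nonneg {N B : ℕ} {cTX φ : ℝ} (hc : 0 ≤ cTX) (hφ : 0 ≤ φ) (n : Fin N)
    (D : Instr N B) : 0 ≤ nodeCost cTX φ n D := by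
  unfold nodeCost
  split_ifs
  · positivity
  · exact le_rfl

/-! ### Measurability -/

section Measurability

variable {N B : ℕ}

/-- There are finitely many channel assignments, so every condition on them is measurable. -/
lemma measurableSet_channels (p : (Fin N → Fin (B + 1)) → Prop) :
    MeasurableSet {D : Instr N B | p fun m => (D m).1} := by
  have hc : Measurable (fun D : Instr N B => fun m => (D m).1) := by fun_prop
  exact hc (Set.toFinite {c | p c}).measurableSet

lemma measurable_numActive : Measurable (numActive : Instr N B → ℕ) := by
  classical
  have hc : Measurable (fun D : Instr N B => fun m => (D m).1) := by fun_prop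
  have h : (numActive : Instr N B → ℕ) =
      (fun c : Fin N → Fin (B + 1) => (Finset.univ.filter fun n => c n ≠ 0).card) ∘
        fun D m => (D m).1 := by
    ext D
    simp only [numActive, Active, Function.comp]
    congr
  rw [h]
  exact (measurable_of_finite _).comp hc

lemma measurable_commonSNR : Measurable (commonSNR : Instr N B → ℝ≥0) := by
  classical
  -- This removes the dependence of the index set on `D`: idle nodes contribute `0`, the least
  -- element of `ℝ≥0`.
  have h : (commonSNR : Instr N B → ℝ≥0) =
      fun D => Finset.univ.sup (fun n => if Active D n then (D n).2 else 0) := by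
    ext D
    unfold commonSNR
    congr 1
    refine le_antisymm (Finset.sup_le fun n hn => ?_) (Finset.sup_le fun n _ => ?_)
    · have hn' : Active D n := by simpa using hn
      refine le_trans ?_ (Finset.le_sup (Finset.mem_univ n))
      simp [hn']
    · split_ifs with hn
      · exact Finset.le_sup (f := fun n => (D n).2) (by simpa using hn)
      · exact zero_le
  rw [h]
  have : ∀ s : Finset (Fin N), Measurable
      fun D : Instr N B => s.sup (fun n => if Active D n then (D n).2 else 0) := by
    intro s
    induction s using Finset.induction_on with
    | empty => simp
    | insert a s ha ih =>
      simp only [Finset.sup_insert]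
      refine Measurable.sup (Measurable.ite ?_ (by fun_prop) measurable_const) ih
      exact measurableSet_channels fun c => c a ≠ 0
  exact this _

lemma measurable_nodeCost (cTX φ : ℝ) (n : Fin N) :
    Measurable (nodeCost cTX φ n : Instr N B → ℝ) := by
  classical
  unfold nodeCost
  exact Measurable.ite (measurableSet_channels fun c => c n ≠ 0) (by fun_prop) measurable_const

/-- `numActive` takes values in `ℕ`, so `scdpInstr` needs a version in which `t` is not confined to
`Fin (B + 1)`. -/
lemma measurable_schedule_nat : Measurable
    (fun p : (ℕ × ℝ≥0) × Equiv.Perm (Fin N) => (schedule p.1.1 p.1.2 p.2 : Instr N B)) := by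
  have h1 : ∀ q : ℕ × Equiv.Perm (Fin N),
      Measurable (fun S : ℝ≥0 => (schedule q.1 S q.2 : Instr N B)) := by
    intro q
    refine measurable_pi_lambda _ fun n => ?_
    unfold schedule
    split_ifs <;> fun_prop
  have h2 : Measurable (fun p : (ℕ × Equiv.Perm (Fin N)) × ℝ≥0 =>
      (schedule p.1.1 p.2 p.1.2 : Instr N B)) := measurable_from_prod_countable_right h1
  exact h2.comp (f := fun p : (ℕ × ℝ≥0) × Equiv.Perm (Fin N) => ((p.1.1, p.2), p.1.2))
    (by fun_prop)

lemma measurable_aggSNR_prod {Γ : Finset ℝ} (SA : ℝ) :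
    Measurable (fun p : (Fin N → Γ) × Instr N B => aggSNR SA (fun n => (p.1 n : ℝ)) p.2) := by
  exact measurable_from_prod_countable_right
    (f := fun p : (Fin N → Γ) × Instr N B => aggSNR SA (fun n => (p.1 n : ℝ)) p.2)
    fun g => measurable_aggSNR SA fun n => (g n : ℝ)

lemma measurable_scdpInstr {Γ : Finset ℝ} (k : ℕ) :
    Measurable (fun ω : JointPath N B Γ => scdpInstr ω k) := by
  have h1 : Measurable (fun ω : JointPath N B Γ => (ω.1 k).2) := by fun_prop
  have h2 : Measurable (fun ω : JointPath N B Γ => (ω.2 k).2) := by fun_prop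
  exact measurable_schedule_nat.comp
    (((measurable_numActive.comp h1).prodMk (measurable_commonSNR.comp h1)).prodMk h2)

lemma measurable_scdpSNR {Γ : Finset ℝ} (SA : ℝ) (k : ℕ) :
    Measurable (fun ω : JointPath N B Γ => scdpSNR SA ω k) := by
  have h1 : Measurable (fun ω : JointPath N B Γ => (ω.2 k).1) := by fun_prop
  exact (measurable_aggSNR_prod SA).comp (h1.prodMk (measurable_scdpInstr k))

end Measurability

/-! ### Laws of the instructions, of the accuracy states and of the rankings in a single slot -/

instance instProbPolicyLaw {N B : ℕ} (α SA V0 : ℝ) (δ : Policy N B) :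
    IsProbabilityMeasure (policyLaw α SA V0 δ) := by
  unfold policyLaw; infer_instance

/-- The mixing measure is the law of the prior variance, but its identity is irrelevant: properties
shared by all the laws `δ.ker k v` pass to the mixture. -/
lemma exists_map_instr_policyLaw {N B : ℕ} (α SA V0 : ℝ) (δ : Policy N B) (k : ℕ) :
    ∃ m : Measure ℝ, (policyLaw α SA V0 δ).map (fun ω => (ω k).2) = δ.ker k ∘ₘ m := by
  have h0 : ∀ k, (policyLaw α SA V0 δ).map (fun ω => (ω k).2) =
      ((policyLaw α SA V0 δ).map (fun ω => ω k)).map Prod.snd := fun k =>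
    (Measure.map_map measurable_snd (measurable_pi_apply k)).symm
  rw [h0]
  cases k with
  | zero =>
    refine ⟨Measure.dirac V0, ?_⟩
    unfold policyLaw
    rw [map_zero_markovLaw, ← Kernel.map_apply _ measurable_snd, ← Kernel.snd_eq, Kernel.snd_prod,
      Measure.dirac_bind (Kernel.measurable _)]
  | succ k =>
    refine ⟨((policyLaw α SA V0 δ).map fun ω => ω k).map
      fun s => nu α (nuHat s.1 (bestSNR SA s.2)), ?_⟩
    have h1 := map_succ_markovLaw ((Kernel.id ×ₖ δ.ker 0) V0)
      (fun k => (Kernel.id ×ₖ δ.ker (k + 1)).comap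
        (fun s : ℝ × Instr N B => nu α (nuHat s.1 (bestSNR SA s.2))) (measurable_nextPrior α SA)) k
    change (policyLaw α SA V0 δ).map _ = _ ∘ₘ (policyLaw α SA V0 δ).map _ at h1
    rw [h1, Measure.map_comp _ _ measurable_snd, ← Measure.deterministic_comp_eq_map
      (measurable_nextPrior α SA), Measure.comp_assoc, Kernel.comp_deterministic_eq_comap,
      ← Kernel.comap_map_comm _ (measurable_nextPrior α SA) measurable_snd, ← Kernel.snd_eq, Kernel.snd_prod]

section Sensors

variable {N : ℕ} {Γ : Finset ℝ}

/-- It suffices to check boxes. There the sum over all state vectors factors into one sum per node,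
and each factor is handled by `hπ`. -/
lemma bind_pi_eq_pi (P : Γ → PMF Γ) (π : PMF Γ) (hπ : π.bind P = π) :
    accuracyStep P ∘ₘ Measure.pi (fun _ : Fin N => π.toMeasure) =
      Measure.pi fun _ : Fin N => π.toMeasure := by
  symm
  refine Measure.pi_eq fun s hs => ?_
  rw [Measure.bind_apply (MeasurableSet.univ_pi hs) (Kernel.aemeasurable _)]
  have h1 : ∀ γ : Fin N → Γ, accuracyStep P γ (Set.univ.pi s) =
      ∏ n, (P (γ n)).toMeasure (s n) := fun γ => by
    change Measure.pi (fun n => (P (γ n)).toMeasure) (Set.univ.pi s) = _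
    rw [Measure.pi_pi]
  simp only [h1]
  have h2 : ∀ n, π.toMeasure (s n) = ∑ g, π g * (P g).toMeasure (s n) := fun n => by
    conv_lhs => rw [← hπ]
    rw [PMF.toMeasure_bind_apply _ _ _ (hs n), tsum_fintype]
  simp only [h2, Finset.prod_univ_sum, Fintype.piFinset_univ, Finset.prod_mul_distrib]
  rw [lintegral_fintype]
  refine Finset.sum_congr rfl fun γ _ => ?_
  rw [Measure.pi_singleton, mul_comm]
  simp

instance instProbSensorLaw (π : PMF Γ) (P : Γ → PMF Γ)
    (ρ : (Fin N → Γ) → PMF (Equiv.Perm (Fin N))) : IsProbabilityMeasure (sensorLaw π P ρ) := by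
  unfold sensorLaw; infer_instance

/-- A step forgets the old ranking, moves the accuracy states by a kernel that preserves the product
law, and draws a fresh ranking. -/
lemma map_sensorLaw {P : Γ → PMF Γ} {π : PMF Γ} (hπ : π.bind P = π)
    (ρ : (Fin N → Γ) → PMF (Equiv.Perm (Fin N))) (k : ℕ) :
    (sensorLaw π P ρ).map (fun ω => ω k) =
      (Kernel.id ×ₖ rankKernel ρ) ∘ₘ Measure.pi (fun _ : Fin N => π.toMeasure) := by
  induction k with
  | zero => exact map_zero_markovLaw _ _
  | succ k ih =>
    have h1 := map_succ_markovLaw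
      ((Kernel.id ×ₖ rankKernel ρ) ∘ₘ Measure.pi (fun _ : Fin N => π.toMeasure))
      (fun _ => ((Kernel.id ×ₖ rankKernel ρ) ∘ₖ accuracyStep P).comap Prod.fst measurable_fst) k
    change (sensorLaw π P ρ).map _ = _ ∘ₘ (sensorLaw π P ρ).map _ at h1
    rw [h1, ih, ← Kernel.comp_deterministic_eq_comap, ← Measure.comp_assoc,
      Measure.deterministic_comp_eq_map, Measure.map_comp _ _ measurable_fst, ← Kernel.fst_eq,
      Kernel.fst_prod, Measure.id_comp, ← Measure.comp_assoc, bind_pi_eq_pi P π hπ]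

lemma map_accuracy_sensorLaw {P : Γ → PMF Γ} {π : PMF Γ} (hπ : π.bind P = π)
    (ρ : (Fin N → Γ) → PMF (Equiv.Perm (Fin N))) (k : ℕ) :
    (sensorLaw π P ρ).map (fun ω => (ω k).1) = Measure.pi (fun _ : Fin N => π.toMeasure) := by
  have h0 : (sensorLaw π P ρ).map (fun ω => (ω k).1) =
      ((sensorLaw π P ρ).map (fun ω => ω k)).map Prod.fst :=
    (Measure.map_map measurable_fst (measurable_pi_apply k)).symm
  rw [h0, map_sensorLaw hπ, Measure.map_comp _ _ measurable_fst, ← Kernel.fst_eq,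
    Kernel.fst_prod, Measure.id_comp]

lemma map_ranking_sensorLaw {P : Γ → PMF Γ} {π : PMF Γ} (hπ : π.bind P = π)
    (ρ : (Fin N → Γ) → PMF (Equiv.Perm (Fin N))) (k : ℕ) :
    (sensorLaw π P ρ).map (fun ω => (ω k).2) =
      rankKernel ρ ∘ₘ Measure.pi (fun _ : Fin N => π.toMeasure) := by
  have h0 : (sensorLaw π P ρ).map (fun ω => (ω k).2) =
      ((sensorLaw π P ρ).map (fun ω => ω k)).map Prod.snd :=
    (Measure.map_map measurable_snd (measurable_pi_apply k)).symm
  rw [h0, map_sensorLaw hπ, Measure.map_comp _ _ measurable_snd, ← Kernel.snd_eq,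
    Kernel.snd_prod]

lemma ae_isRanking {P : Γ → PMF Γ} {π : PMF Γ} (hπ : π.bind P = π)
    {ρ : (Fin N → Γ) → PMF (Equiv.Perm (Fin N))} (hρ : IsRankingRule ρ) (k : ℕ) :
    ∀ᵐ ω ∂sensorLaw π P ρ, IsRanking (ω k).1 (ω k).2 := by
  have hm : MeasurableSet {x : (Fin N → Γ) × Equiv.Perm (Fin N) | IsRanking x.1 x.2} :=
    (Set.to_countable _).measurableSet
  have h1 : ∀ᵐ x ∂(sensorLaw π P ρ).map (fun ω => ω k), IsRanking x.1 x.2 := by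
    rw [map_sensorLaw hπ, ae_iff]
    change (_ ∘ₘ _ : Measure _) {x : (Fin N → Γ) × Equiv.Perm (Fin N) | IsRanking x.1 x.2}ᶜ = 0
    rw [Measure.bind_apply hm.compl (Kernel.aemeasurable _),
      lintegral_eq_zero_iff (Kernel.measurable_coe _ hm.compl)]
    refine Eventually.of_forall fun γ => ?_
    beta_reduce
    rw [Kernel.prod_apply, Kernel.id_apply, Pi.zero_apply, ← nonpos_iff_eq_zero]
    rw [Measure.dirac_prod, Measure.map_apply (by fun_prop) hm.compl]
    change (ρ γ).toMeasure _ ≤ 0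
    rw [nonpos_iff_eq_zero, PMF.toMeasure_apply_eq_zero_iff _ (by trivial),
      Set.disjoint_left]
    intro r hr hr'
    exact hr' (hρ γ r hr)
  exact ae_of_ae_map (measurable_pi_apply k).aemeasurable h1

end Sensors

/-! ### Symmetry of the node costs -/

/-- A law on rankings under which no node is distinguished. -/
def IsExchangeable {N : ℕ} (Q : Measure (Equiv.Perm (Fin N))) : Prop :=
  ∀ σ : Equiv.Perm (Fin N), Q.map (σ * ·) = Q

/-- Left multiplication by the transposition of `n` and `m` exchanges their positions in the list
and preserves `Q`. -/
lemma lintegral_nodeCost_schedule {N B t : ℕ} (cTX φ : ℝ) (S : ℝ≥0) (htB : t ≤ B)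
    {Q : Measure (Equiv.Perm (Fin N))} (hQ : IsExchangeable Q) (n m : Fin N) :
    ∫⁻ r, ENNReal.ofReal (nodeCost cTX φ n (schedule t S r : Instr N B)) ∂Q =
      ∫⁻ r, ENNReal.ofReal (nodeCost cTX φ m (schedule t S r : Instr N B)) ∂Q := by
  conv_lhs => rw [← hQ (Equiv.swap n m)]
  rw [lintegral_map measurable_from_top measurable_from_top]
  refine lintegral_congr fun r => ?_
  simp only [nodeCost_schedule S _ htB]
  have : (Equiv.swap n m * r).symm n = r.symm m := by
    rw [Equiv.symm_apply_eq]
    simp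
  rw [this]

lemma isExchangeable_uniform (N : ℕ) :
    IsExchangeable (PMF.uniformOfFintype (Equiv.Perm (Fin N))).toMeasure := by
  intro σ
  refine Measure.ext_of_singleton fun r => ?_
  rw [Measure.map_apply measurable_from_top (by trivial)]
  have : (fun x => σ * x) ⁻¹' {r} = {σ⁻¹ * r} := by
    ext x
    simp [eq_inv_mul_iff_mul_eq]
  rw [this, PMF.toMeasure_apply_singleton _ _ (by trivial),
    PMF.toMeasure_apply_singleton _ _ (by trivial)]
  simp

/-- Relabelling by `σ` maps the rankings of `γ` bijectively onto those of `γ ∘ σ⁻¹`, so the uniform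
choice among them is equivariant; the i.i.d. law of `γ` is invariant under relabelling. -/
lemma isExchangeable_rankKernel_uniformRanking {N : ℕ} {Γ : Finset ℝ} (π : PMF Γ) :
    IsExchangeable (rankKernel uniformRanking ∘ₘ Measure.pi (fun _ : Fin N => π.toMeasure)) := by
  classical
  intro σ
  have hmap : Measurable fun r : Equiv.Perm (Fin N) => σ * r := measurable_from_top
  rw [Measure.map_comp _ _ hmap]
  have hs : ∀ (γ : Fin N → Γ) (r : Equiv.Perm (Fin N)),
      IsRanking γ (σ⁻¹ * r) ↔ IsRanking (fun n => γ (σ⁻¹ n)) r := fun γ r => Iff.rfl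
  have hk : (rankKernel (uniformRanking (N := N) (Γ := Γ))).map (σ * ·) =
      (rankKernel uniformRanking).comap (fun γ n => γ (σ⁻¹ n)) (by fun_prop) := by
    ext1 γ
    refine Measure.ext_of_singleton fun r => ?_
    rw [Kernel.map_apply _ hmap, Kernel.comap_apply, Measure.map_apply hmap (by trivial)]
    have : (fun x => σ * x) ⁻¹' {r} = {σ⁻¹ * r} := by
      ext x
      simp [eq_inv_mul_iff_mul_eq]
    rw [this]
    change (uniformRanking γ).toMeasure _ = (uniformRanking fun n => γ (σ⁻¹ n)).toMeasure _
    rw [PMF.toMeasure_apply_singleton _ _ (by trivial),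
      PMF.toMeasure_apply_singleton _ _ (by trivial), uniformRanking, uniformRanking,
      PMF.uniformOfFinset_apply, PMF.uniformOfFinset_apply]
    have hcard : (Finset.univ.filter (IsRanking γ)).card =
        (Finset.univ.filter (IsRanking fun n => γ (σ⁻¹ n))).card := by
      refine Finset.card_equiv (Equiv.mulLeft σ) fun r => ?_
      simp only [Finset.mem_filter, Finset.mem_univ, true_and, Equiv.coe_mulLeft]
      rw [← hs, inv_mul_cancel_left]
    simp only [Finset.mem_filter, Finset.mem_univ, true_and, hs, hcard]
  rw [hk, ← Kernel.comp_deterministic_eq_comap, ← Measure.comp_assoc,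
    Measure.deterministic_comp_eq_map]
  have he : (fun (γ : Fin N → Γ) n => γ (σ⁻¹ n)) =
      MeasurableEquiv.piCongrLeft (fun _ : Fin N => Γ) σ := by
    ext γ n
    simp [MeasurableEquiv.piCongrLeft, Equiv.piCongrLeft]
  rw [he, (measurePreserving_piCongrLeft (fun _ : Fin N => π.toMeasure) σ).map_eq]

/-! ### Deviation bound for the number of nodes in the best state -/

/-- Invert `1 + s + s ^ 2 / 2 ≤ exp s` and use `(1 + s + s ^ 2 / 2) * (1 - s + s ^ 2 / 2) = 1 + s ^
4 / 4 ≥ 1`. -/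
lemma exp_neg_le {s : ℝ} (hs : 0 ≤ s) : Real.exp (-s) ≤ 1 - s + s ^ 2 / 2 := by
  have h := Real.quadratic_le_exp_of_nonneg hs
  rw [Real.exp_neg, inv_le_comm₀ (Real.exp_pos s) (by nlinarith [sq_nonneg (s - 1)])]
  refine le_trans ?_ h
  rw [inv_le_iff_one_le_mul₀ (by nlinarith [sq_nonneg (s - 1)])]
  nlinarith [sq_nonneg (s ^ 2)]

open Classical in
/-- Number of nodes with the best accuracy state. -/
def numBest {N : ℕ} {Γ : Finset ℝ} (γ : Fin N → Γ) : ℕ :=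
  (Finset.univ.filter fun n => (γ n : ℝ) = 1).card

/-- `numBest` is binomial with parameters `N` and `p`. The Chernoff bound uses `exp_neg_le` to keep
the exponent quadratic in `s`. -/
lemma measureReal_numBest_lt_le {N B : ℕ} {Γ : Finset ℝ} (h1 : (1 : ℝ) ∈ Γ) (π : PMF Γ) {p : ℝ}
    (hp : p = (π ⟨1, h1⟩).toReal) (hp0 : 0 < p) (hN : ((B : ℝ) - 1) / p ≤ N) (hN0 : 0 < N) :
    (Measure.pi fun _ : Fin N => π.toMeasure).real {γ | numBest γ < B} ≤
      Real.exp (-((N * p - B + 1) ^ 2 / (2 * (N * p)))) := by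
  classical
  set μ := Measure.pi fun _ : Fin N => π.toMeasure with hμ
  have hNp : 0 < N * p := by positivity
  -- This is the minimizer of the final exponent `s * (B - 1) + N * p * (-s + s ^ 2 / 2)`; `hN`
  -- makes it nonnegative.
  set s : ℝ := (N * p - B + 1) / (N * p) with hs
  have hs0 : 0 ≤ s := by
    rw [div_le_iff₀ hp0] at hN
    exact div_nonneg (by linarith) hNp.le
  -- Integrality lowers the threshold from `B` to `B - 1`, which is the source of the `+ 1` in the
  -- exponent.
  have hsub : {γ : Fin N → Γ | numBest γ < B} ⊆ {γ | (numBest γ : ℝ) ≤ (B : ℝ) - 1} := by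
    intro γ hγ
    have : numBest γ + 1 ≤ B := hγ
    have : (numBest γ : ℝ) + 1 ≤ B := by exact_mod_cast this
    simpa using (by linarith : (numBest γ : ℝ) ≤ (B : ℝ) - 1)
  have hch := measure_le_le_exp_mul_mgf (μ := μ) (X := fun γ => (numBest γ : ℝ)) ((B : ℝ) - 1)
    (neg_nonpos.2 hs0) Integrable.of_finite
  have hmgf : mgf (fun γ : Fin N → Γ => (numBest γ : ℝ)) μ (-s) =
      (1 - p + p * Real.exp (-s)) ^ N := by
    -- As a product of one factor per node, the exponential has a mean that factors by independence.
    have hprod : ∀ γ : Fin N → Γ, Real.exp (-s * numBest γ) =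
        ∏ n, if (γ n : ℝ) = 1 then Real.exp (-s) else 1 := fun γ => by
      rw [Finset.prod_ite, Finset.prod_const, Finset.prod_const_one, mul_one, ← Real.exp_nat_mul,
        mul_comm, numBest]
    simp only [mgf, hprod]
    rw [hμ, integral_fintype_prod_eq_pow (fun g : Γ => if (g : ℝ) = 1 then Real.exp (-s) else 1),
      Fintype.card_fin]
    congr 1
    rw [PMF.integral_eq_sum]
    have hone : ∑ g, (π g).toReal = 1 := by
      rw [← ENNReal.toReal_sum fun g _ => π.apply_ne_top g,
        (tsum_fintype _).symm.trans π.tsum_coe, ENNReal.toReal_one]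
    have hsplit : ∀ g : Γ, (π g).toReal • (if (g : ℝ) = 1 then Real.exp (-s) else 1) =
        (π g).toReal + if g = ⟨1, h1⟩ then (π g).toReal * (Real.exp (-s) - 1) else 0 := fun g => by
      by_cases hg : (g : ℝ) = 1
      · have hg' : g = ⟨1, h1⟩ := Subtype.ext hg
        simp only [hg', if_true, smul_eq_mul]; ring
      · have hg' : g ≠ ⟨1, h1⟩ := fun h => hg (by rw [h])
        simp [hg, hg']
    simp only [hsplit, Finset.sum_add_distrib, hone, Finset.sum_ite_eq', Finset.mem_univ, if_true,
      ← hp]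
    ring
  have hp1 : p ≤ 1 := by
    rw [hp]
    exact ENNReal.toReal_le_of_le_ofReal zero_le_one (by simpa using π.coe_le_one _)
  have hbase : (1 - p + p * Real.exp (-s)) ^ N ≤ Real.exp (N * (p * (-s + s ^ 2 / 2))) := by
    rw [Real.exp_nat_mul]
    refine pow_le_pow_left₀ (by nlinarith [Real.exp_pos (-s)]) ?_ N
    have := Real.add_one_le_exp (p * (-s + s ^ 2 / 2))
    nlinarith [mul_le_mul_of_nonneg_left (exp_neg_le hs0) hp0.le]
  refine (measureReal_mono hsub).trans (hch.trans ?_)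
  rw [hmgf]
  refine (mul_le_mul_of_nonneg_left hbase (Real.exp_pos _).le).trans ?_
  rw [← Real.exp_add, Real.exp_le_exp]
  apply le_of_eq
  rw [hs]
  field_simp
  ring

/-- Expand the square and drop the term `(b - 1) ^ 2 / (2 * x)`. -/
lemma exp_deviation_le {x b : ℝ} (hx : 0 < x) :
    Real.exp (-((x - b + 1) ^ 2 / (2 * x))) ≤ Real.exp (b - 1) * Real.exp (-(x / 2)) := by
  rw [← Real.exp_add, Real.exp_le_exp]
  have : (b - 1) + -(x / 2) - -((x - b + 1) ^ 2 / (2 * x)) = (b - 1) ^ 2 / (2 * x) := by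
    field_simp
    ring
  have h2 : 0 ≤ (b - 1) ^ 2 / (2 * x) := by positivity
  linarith

/-- If enough nodes have the best state, then the nodes of best rank do. -/
lemma IsRanking.eq_one_of_lt {N : ℕ} {Γ : Finset ℝ} (hΓ : ∀ g ∈ Γ, g ≤ 1) {γ : Fin N → Γ}
    {r : Equiv.Perm (Fin N)} (hr : IsRanking γ r) {i : Fin N} (hi : (i : ℕ) < numBest γ) :
    (γ (r i) : ℝ) = 1 := by
  classical
  by_contra hne
  have hlt : (γ (r i) : ℝ) < 1 := lt_of_le_of_ne (hΓ _ (γ (r i)).2) hne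
  -- If the node at position `i` is below `1`, all nodes in state `1` precede it, so there are at
  -- most `i` of them.
  have hsub : (Finset.univ.filter fun n => (γ n : ℝ) = 1).map r.symm.toEmbedding ⊆
      Finset.Iio i := by
    intro j hj
    rw [Finset.mem_map_equiv, Equiv.symm_symm, Finset.mem_filter] at hj
    rw [Finset.mem_Iio]
    by_contra hij
    have := hr (not_lt.1 hij)
    simp only [hj.2] at this
    linarith
  have := Finset.card_le_card hsub
  rw [Finset.card_map, Fin.card_Iio] at this
  unfold numBest at hi
  exact absurd hi (not_lt.2 (by convert this))

/-! ### Instructions drawn by a rule -/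

section Rules

variable {N B : ℕ} (α SA V0 : ℝ) (δ : Rule B)

/-- Every draw of the policy has the form `schedule t S r` with `t ≤ B`, so the failure set has
empty preimage. -/
lemma ae_instr_of_forall_schedule {p : Instr N B → Prop} (hm : MeasurableSet {D | p D})
    (hp : ∀ (t : ℕ) (S : ℝ≥0) (r : Equiv.Perm (Fin N)), t ≤ B → p (schedule t S r)) (k : ℕ) :
    ∀ᵐ ω ∂policyLaw α SA V0 (δ.toPolicy N), p (ω k).2 := by
  obtain ⟨m, h⟩ := exists_map_instr_policyLaw α SA V0 (δ.toPolicy N) k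
  have h1 : ∀ᵐ D ∂(policyLaw α SA V0 (δ.toPolicy N)).map (fun ω => (ω k).2), p D := by
    rw [h, ae_iff]
    change (_ ∘ₘ _ : Measure _) {D : Instr N B | p D}ᶜ = 0
    rw [Measure.bind_apply hm.compl (Kernel.aemeasurable _),
      lintegral_eq_zero_iff (Kernel.measurable_coe _ hm.compl)]
    refine Eventually.of_forall fun v => ?_
    beta_reduce
    change (Kernel.map _ _ v) _ = 0
    rw [Kernel.map_apply' _ measurable_schedule _ hm.compl]
    have he : (fun x : (Fin (B + 1) × ℝ≥0) × Equiv.Perm (Fin N) =>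
        (schedule (x.1.1 : ℕ) x.1.2 x.2 : Instr N B)) ⁻¹' {D | p D}ᶜ = ∅ := by
      ext x
      simpa using hp _ _ _ (Nat.le_of_lt_succ x.1.1.2)
    rw [he, measure_empty]
  exact ae_of_ae_map (f := fun ω : ℕ → ℝ × Instr N B => (ω k).2)
    (Measurable.aemeasurable (by fun_prop)) h1

/-- The number of active nodes and the common SNR determine the collected SNR and the total cost. -/
lemma ae_instr_policyLaw (hBN : B ≤ N) (cTX φ : ℝ) (k : ℕ) :
    ∀ᵐ ω ∂policyLaw α SA V0 (δ.toPolicy N), numActive (ω k).2 ≤ B ∧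
      bestSNR SA (ω k).2 =
        numActive (ω k).2 * (SA * commonSNR (ω k).2 / (SA + commonSNR (ω k).2)) ∧
      ∑ n, nodeCost cTX φ n (ω k).2 = numActive (ω k).2 * (cTX + φ * commonSNR (ω k).2) := by
  have hnum : Measurable fun D : Instr N B => (numActive D : ℝ) :=
    measurable_from_top.comp measurable_numActive
  have hsnr : Measurable fun D : Instr N B => (commonSNR D : ℝ) :=
    measurable_commonSNR.coe_nnreal_real
  have hbest : Measurable (bestSNR SA : Instr N B → ℝ) := measurable_aggSNR SA _
  refine ae_instr_of_forall_schedule α SA V0 δ (p := fun D => numActive D ≤ B ∧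
      bestSNR SA D = numActive D * (SA * commonSNR D / (SA + commonSNR D)) ∧
      ∑ n, nodeCost cTX φ n D = numActive D * (cTX + φ * commonSNR D)) ?_ ?_ k
  · refine (measurableSet_le measurable_numActive measurable_const).inter
      ((measurableSet_eq_fun hbest (by fun_prop)).inter (measurableSet_eq_fun ?_ (by fun_prop)))
    exact Finset.measurable_sum _ fun n _ => measurable_nodeCost cTX φ n
  · intro t S r htB
    have htN := htB.trans hBN
    rw [numActive_schedule S r htB htN, bestSNR_schedule S r htB htN,
      sum_nodeCost_schedule S r htB htN]
    refine ⟨htB, ?_⟩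
    -- For `t = 0` the recovered SNR may differ from `S`, but the factor `t` kills both sides.
    rcases Nat.eq_zero_or_pos t with rfl | ht
    · simp
    · rw [commonSNR_schedule S r htB htN ht]
      exact ⟨rfl, rfl⟩

end Rules

/-! ### Costs -/

section Costs

variable {N B : ℕ} {cTX φ : ℝ}

lemma avgCost_eq {Ω : Type*} [MeasurableSpace Ω] (hc : 0 ≤ cTX) (hφ : 0 ≤ φ) (n : Fin N)
    (μ : Measure Ω) {D : Ω → ℕ → Instr N B} (hD : ∀ k, Measurable fun ω => D ω k) (T : ℕ) :
    avgCost cTX φ n μ D T = ENNReal.ofReal (1 / ((T : ℝ) + 1)) *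
      ∑ k ∈ Finset.range (T + 1), ∫⁻ ω, ENNReal.ofReal (nodeCost cTX φ n (D ω k)) ∂μ := by
  have hm : ∀ k, Measurable fun ω => ENNReal.ofReal (nodeCost cTX φ n (D ω k)) := fun k =>
    ((measurable_nodeCost cTX φ n).comp (hD k)).ennreal_ofReal
  rw [← lintegral_finsetSum _ fun k _ => hm k, ← lintegral_const_mul _
    (Finset.measurable_sum _ fun k _ => hm k)]
  refine lintegral_congr fun ω => ?_
  rw [sampleCost, ENNReal.ofReal_mul (by positivity),
    ENNReal.ofReal_sum_of_nonneg fun k _ => nodeCost_nonneg hc hφ n _]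

lemma sum_lintegral_nodeCost {Ω : Type*} [MeasurableSpace Ω] (hc : 0 ≤ cTX) (hφ : 0 ≤ φ)
    (μ : Measure Ω) {D : Ω → Instr N B} (hD : Measurable D) :
    ∑ n, ∫⁻ ω, ENNReal.ofReal (nodeCost cTX φ n (D ω)) ∂μ =
      ∫⁻ ω, ENNReal.ofReal (∑ n, nodeCost cTX φ n (D ω)) ∂μ := by
  have hm : ∀ n, Measurable fun ω => ENNReal.ofReal (nodeCost cTX φ n (D ω)) := fun n =>
    ((measurable_nodeCost cTX φ n).comp hD).ennreal_ofReal
  rw [← lintegral_finsetSum _ fun n _ => hm n]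
  refine lintegral_congr fun ω => ?_
  rw [ENNReal.ofReal_sum_of_nonneg fun n _ => nodeCost_nonneg hc hφ n _]

variable {Γ : Finset ℝ} (α SA V0 : ℝ) (δ : Rule B) (π : PMF Γ) (P : Γ → PMF Γ)
  (ρ : (Fin N → Γ) → PMF (Equiv.Perm (Fin N)))

instance instProbJointLaw (δ : Policy N B) : IsProbabilityMeasure (jointLaw α SA V0 δ π P ρ) := by
  unfold jointLaw; infer_instance

lemma ae_jointLaw_of_policyLaw {δ : Policy N B} {p : (ℕ → ℝ × Instr N B) → Prop}
    (h : ∀ᵐ ω ∂policyLaw α SA V0 δ, p ω) : ∀ᵐ ω ∂jointLaw α SA V0 δ π P ρ, p ω.1 :=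
  Measure.quasiMeasurePreserving_fst.ae h

lemma ae_jointLaw_of_sensorLaw {δ : Policy N B}
    {p : (ℕ → (Fin N → Γ) × Equiv.Perm (Fin N)) → Prop}
    (h : ∀ᵐ ω ∂sensorLaw π P ρ, p ω) : ∀ᵐ ω ∂jointLaw α SA V0 δ π P ρ, p ω.2 :=
  Measure.quasiMeasurePreserving_snd.ae h

/-- The costs of all nodes together agree slot by slot. -/
lemma sum_lintegral_scdp_eq (hBN : B ≤ N) (hc : 0 ≤ cTX) (hφ : 0 ≤ φ) (k : ℕ) :
    ∑ n, ∫⁻ ω, ENNReal.ofReal (nodeCost cTX φ n (scdpInstr ω k))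
        ∂jointLaw α SA V0 (δ.toPolicy N) π P ρ =
      ∑ n, ∫⁻ ω, ENNReal.ofReal (nodeCost cTX φ n (ω k).2)
        ∂policyLaw α SA V0 (δ.toPolicy N) := by
  have hD : Measurable fun ω : ℕ → ℝ × Instr N B => (ω k).2 := by fun_prop
  rw [sum_lintegral_nodeCost hc hφ _ (measurable_scdpInstr k),
    sum_lintegral_nodeCost hc hφ _ hD]
  have hmp : MeasurePreserving Prod.fst (jointLaw α SA V0 (δ.toPolicy N) π P ρ)
      (policyLaw α SA V0 (δ.toPolicy N)) := measurePreserving_fst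
  have hm : Measurable fun ω : ℕ → ℝ × Instr N B =>
      ENNReal.ofReal (∑ n, nodeCost cTX φ n (ω k).2) :=
    (Finset.measurable_sum _ fun n _ => (measurable_nodeCost cTX φ n).comp hD).ennreal_ofReal
  rw [← hmp.lintegral_comp hm]
  refine lintegral_congr_ae ?_
  filter_upwards [ae_jointLaw_of_policyLaw α SA V0 π P ρ
    (ae_instr_policyLaw α SA V0 δ hBN cTX φ k)] with ω hω
  rw [hω.2.2, scdpInstr, sum_nodeCost_schedule _ _ hω.1 (hω.1.trans hBN)]

lemma sum_scdpCost_eq (hBN : B ≤ N) (hc : 0 ≤ cTX) (hφ : 0 ≤ φ) (T : ℕ) :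
    ∑ n, scdpCost α SA V0 cTX φ (δ.toPolicy N) π P ρ n T =
      ∑ n, bestCost α SA V0 cTX φ (δ.toPolicy N) n T := by
  have h1 : ∀ n, scdpCost α SA V0 cTX φ (δ.toPolicy N) π P ρ n T = _ := fun n =>
    avgCost_eq hc hφ n _ measurable_scdpInstr T
  have h2 : ∀ n, bestCost α SA V0 cTX φ (δ.toPolicy N) n T = _ := fun n =>
    avgCost_eq hc hφ n _ (fun k => by fun_prop) T
  simp only [h1, h2, ← Finset.mul_sum]
  rw [Finset.sum_comm, Finset.sum_comm (s := Finset.univ)]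
  simp only [sum_lintegral_scdp_eq α SA V0 δ π P ρ hBN hc hφ]

/-- Given the prior variance and `(t, S)`, the list of nodes is a uniform permutation, so the
innermost integral does not depend on the node. -/
lemma bestCost_eq_bestCost (hc : 0 ≤ cTX) (hφ : 0 ≤ φ) (n m : Fin N) (T : ℕ) :
    bestCost α SA V0 cTX φ (δ.toPolicy N) n T = bestCost α SA V0 cTX φ (δ.toPolicy N) m T := by
  have h2 : ∀ n, bestCost α SA V0 cTX φ (δ.toPolicy N) n T = _ := fun n =>
    avgCost_eq hc hφ n _ (fun k => by fun_prop) T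
  rw [h2, h2]
  congr 1
  refine Finset.sum_congr rfl fun k _ => ?_
  obtain ⟨μ, h⟩ := exists_map_instr_policyLaw α SA V0 (δ.toPolicy N) k
  have hf : ∀ n, Measurable fun D : Instr N B => ENNReal.ofReal (nodeCost cTX φ n D) := fun n =>
    (measurable_nodeCost cTX φ n).ennreal_ofReal
  have hker : ∀ n, ∫⁻ ω, ENNReal.ofReal (nodeCost cTX φ n (ω k).2)
      ∂policyLaw α SA V0 (δ.toPolicy N) =
      ∫⁻ v, ∫⁻ q, ∫⁻ r, ENNReal.ofReal
        (nodeCost cTX φ n (schedule (q.1 : ℕ) q.2 r : Instr N B))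
        ∂(PMF.uniformOfFintype (Equiv.Perm (Fin N))).toMeasure ∂δ.ker k v ∂μ := fun n => by
    rw [← lintegral_map (hf n) (g := fun ω : ℕ → ℝ × Instr N B => (ω k).2) (by fun_prop), h,
      Measure.lintegral_bind (Kernel.aemeasurable _) (hf n).aemeasurable]
    refine lintegral_congr fun v => ?_
    change ∫⁻ D, _ ∂(Kernel.map _ _ v) = _
    rw [Kernel.map_apply _ measurable_schedule, lintegral_map (hf n) measurable_schedule,
      Kernel.prod_apply, Kernel.const_apply]
    exact lintegral_prod _ ((hf n).comp measurable_schedule).aemeasurable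
  rw [hker, hker]
  refine lintegral_congr fun v => lintegral_congr fun q => ?_
  exact lintegral_nodeCost_schedule cTX φ q.2 (Nat.le_of_lt_succ q.1.2)
    (isExchangeable_uniform N) n m

/-- By independence the ranking can be integrated first, with `(t, S)` fixed, and its one-slot law
is exchangeable. -/
lemma scdpCost_eq_scdpCost (hBN : B ≤ N) (hc : 0 ≤ cTX) (hφ : 0 ≤ φ) (hπ : π.bind P = π)
    (n m : Fin N) (T : ℕ) :
    scdpCost α SA V0 cTX φ (δ.toPolicy N) π P uniformRanking n T =
      scdpCost α SA V0 cTX φ (δ.toPolicy N) π P uniformRanking m T := by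
  have h1 : ∀ n, scdpCost α SA V0 cTX φ (δ.toPolicy N) π P uniformRanking n T = _ := fun n =>
    avgCost_eq hc hφ n _ measurable_scdpInstr T
  rw [h1, h1]
  congr 1
  refine Finset.sum_congr rfl fun k _ => ?_
  have hf : ∀ n, Measurable fun ω : JointPath N B Γ =>
      ENNReal.ofReal (nodeCost cTX φ n (scdpInstr ω k)) := fun n =>
    ((measurable_nodeCost cTX φ n).comp (measurable_scdpInstr k)).ennreal_ofReal
  have hjoint : ∀ n, ∫⁻ ω, ENNReal.ofReal (nodeCost cTX φ n (scdpInstr ω k))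
      ∂jointLaw α SA V0 (δ.toPolicy N) π P uniformRanking =
      ∫⁻ ω, ∫⁻ r, ENNReal.ofReal (nodeCost cTX φ n
        (schedule (numActive (ω k).2) (commonSNR (ω k).2) r : Instr N B))
        ∂(rankKernel uniformRanking ∘ₘ Measure.pi (fun _ : Fin N => π.toMeasure))
        ∂policyLaw α SA V0 (δ.toPolicy N) := fun n => by
    rw [jointLaw, lintegral_prod _ (hf n).aemeasurable]
    refine lintegral_congr fun ω => ?_
    rw [← map_ranking_sensorLaw hπ uniformRanking k, lintegral_map measurable_from_top
      (by fun_prop)]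
    rfl
  rw [hjoint, hjoint]
  refine lintegral_congr_ae ?_
  filter_upwards [ae_instr_policyLaw α SA V0 δ hBN cTX φ k] with ω hω
  exact lintegral_nodeCost_schedule cTX φ _ hω.1
    (isExchangeable_rankKernel_uniformRanking π) n m

/-- Both costs are constant over the nodes and have equal sums; the factor `N`, nonzero and finite,
cancels in `ℝ≥0∞` even if the costs are infinite. -/
lemma scdpCost_eq_bestCost (hBN : B ≤ N) (hc : 0 ≤ cTX) (hφ : 0 ≤ φ) (hπ : π.bind P = π)
    (n : Fin N) (T : ℕ) :
    scdpCost α SA V0 cTX φ (δ.toPolicy N) π P uniformRanking n T =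
      bestCost α SA V0 cTX φ (δ.toPolicy N) n T := by
  have h := sum_scdpCost_eq α SA V0 δ π P uniformRanking hBN hc hφ T
  rw [Finset.sum_congr rfl fun m _ =>
      scdpCost_eq_scdpCost α SA V0 δ π P hBN hc hφ hπ m n T,
    Finset.sum_congr rfl fun m _ => bestCost_eq_bestCost α SA V0 δ hc hφ m n T] at h
  have hN : N ≠ 0 := (Fin.pos n).ne'
  simpa [ENNReal.mul_right_inj, hN] using h

end Costs

/-! ### Mean squared error -/

section MSE

variable {N B : ℕ} {Γ : Finset ℝ} {α SA V0 : ℝ} (δ : Rule B) {π : PMF Γ} {P : Γ → PMF Γ}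
  {ρ : (Fin N → Γ) → PMF (Equiv.Perm (Fin N))}

lemma scdpSNR_nonneg (hSA : 0 < SA) (ω : JointPath N B Γ) (k : ℕ) : 0 ≤ scdpSNR SA ω k :=
  aggSNR_nonneg hSA _ _

lemma ae_scdpSNR_le (hBN : B ≤ N) (hSA : 0 < SA) (hΓ : ∀ g ∈ Γ, 0 ≤ g ∧ g ≤ 1) :
    ∀ᵐ ω ∂jointLaw α SA V0 (δ.toPolicy N) π P ρ, ∀ k, scdpSNR SA ω k ≤ bestSNR SA (ω.1 k).2 := by
  rw [ae_all_iff]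
  intro k
  filter_upwards [ae_jointLaw_of_policyLaw α SA V0 π P ρ
    (ae_instr_policyLaw α SA V0 δ hBN 0 0 k)] with ω hω
  rw [hω.2.1]
  exact aggSNR_schedule_le _ _ hω.1 (hω.1.trans hBN) hSA (fun n => (hΓ _ (Subtype.prop _)).1)
    (fun n => (hΓ _ (Subtype.prop _)).2)

lemma ae_scdpSNR_eq (hBN : B ≤ N) (hΓ : ∀ g ∈ Γ, 0 ≤ g ∧ g ≤ 1) (hπ : π.bind P = π)
    (hρ : IsRankingRule ρ) (k : ℕ) :
    ∀ᵐ ω ∂jointLaw α SA V0 (δ.toPolicy N) π P ρ, B ≤ numBest (ω.2 k).1 →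
      scdpSNR SA ω k = bestSNR SA (ω.1 k).2 := by
  filter_upwards [ae_jointLaw_of_policyLaw α SA V0 π P ρ
    (ae_instr_policyLaw α SA V0 δ hBN 0 0 k),
    ae_jointLaw_of_sensorLaw α SA V0 π P ρ (δ := δ.toPolicy N) (ae_isRanking hπ hρ k)]
    with ω hω hr hB
  rw [hω.2.1]
  exact aggSNR_schedule_eq _ _ hω.1 (hω.1.trans hBN) SA fun i hi =>
    hr.eq_one_of_lt (fun g hg => (hΓ g hg).2) (hi.trans_le (hω.1.trans hB))

lemma measurable_bestSNR_fst (k : ℕ) :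
    Measurable fun ω : JointPath N B Γ => bestSNR SA (ω.1 k).2 :=
  (measurable_aggSNR SA fun _ => 1).comp (f := fun ω : JointPath N B Γ => (ω.1 k).2) (by fun_prop)

/-- This moves the virtual MSE to the joint space, where it can be compared with SCDP path by path.
-/
lemma bestMSE_eq_avgMSE (δ : Policy N B) (π : PMF Γ) (P : Γ → PMF Γ)
    (ρ : (Fin N → Γ) → PMF (Equiv.Perm (Fin N))) (T : ℕ) :
    bestMSE α SA V0 δ T =
      avgMSE α V0 (jointLaw α SA V0 δ π P ρ) (fun ω k => bestSNR SA (ω.1 k).2) T := by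
  have hmp : MeasurePreserving Prod.fst (jointLaw α SA V0 δ π P ρ) (policyLaw α SA V0 δ) :=
    measurePreserving_fst
  have hm : ∀ k, Measurable fun ω : ℕ → ℝ × Instr N B => bestSNR SA (ω k).2 := fun k =>
    (measurable_aggSNR SA fun _ => 1).comp (f := fun ω : ℕ → ℝ × Instr N B => (ω k).2)
      (by fun_prop)
  unfold bestMSE avgMSE
  rw [← hmp.map_eq, integral_map hmp.aemeasurable]
  refine (Measurable.const_mul ?_ _).aestronglyMeasurable
  exact Finset.measurable_sum _ fun k _ => measurable_postVar α V0 hm k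

lemma average_le {f : ℕ → ℝ} {C : ℝ} (hf : ∀ k, f k ≤ C) (T : ℕ) :
    (1 / ((T : ℝ) + 1)) * ∑ k ∈ Finset.range (T + 1), f k ≤ C := by
  have h := Finset.sum_le_card_nsmul (Finset.range (T + 1)) f C fun k _ => hf k
  rw [Finset.card_range, nsmul_eq_mul] at h
  push_cast at h
  rw [one_div, inv_mul_le_iff₀ (by positivity)]
  exact h

variable (hBN : B ≤ N) (hα0 : 0 ≤ α) (hα1 : α < 1) (hSA : 0 < SA) (hV0 : 0 ≤ V0) (hV1 : V0 ≤ 1)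
include hα0 hα1 hV0 hV1

lemma integrable_postVar {Ω : Type*} [MeasurableSpace Ω] {μ : Measure Ω} [IsFiniteMeasure μ]
    {L : Ω → ℕ → ℝ} (hm : ∀ k, Measurable fun ω => L ω k) (hL : ∀ ω k, 0 ≤ L ω k) (k : ℕ) :
    Integrable (fun ω => postVar α V0 (L ω) k) μ :=
  Integrable.of_bound (measurable_postVar α V0 hm k).aestronglyMeasurable 1
    (Eventually.of_forall fun ω => by
      have := postVar_mem hα0 hα1.le hV0 hV1 (hL ω) k
      rw [Real.norm_eq_abs, abs_of_nonneg this.1]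
      exact this.2)

lemma avgMSE_eq {Ω : Type*} [MeasurableSpace Ω] {μ : Measure Ω} [IsFiniteMeasure μ]
    {L : Ω → ℕ → ℝ} (hm : ∀ k, Measurable fun ω => L ω k) (hL : ∀ ω k, 0 ≤ L ω k) (T : ℕ) :
    avgMSE α V0 μ L T =
      (1 / ((T : ℝ) + 1)) * ∑ k ∈ Finset.range (T + 1), ∫ ω, postVar α V0 (L ω) k ∂μ := by
  unfold avgMSE sampleMSE
  rw [integral_const_mul, integral_finsetSum _ fun k _ =>
    integrable_postVar hα0 hα1 hV0 hV1 hm hL k]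

lemma avgMSE_mem {Ω : Type*} [MeasurableSpace Ω] {μ : Measure Ω} [IsProbabilityMeasure μ]
    {L : Ω → ℕ → ℝ} (hm : ∀ k, Measurable fun ω => L ω k) (hL : ∀ ω k, 0 ≤ L ω k) (T : ℕ) :
    0 ≤ avgMSE α V0 μ L T ∧ avgMSE α V0 μ L T ≤ 1 := by
  rw [avgMSE_eq hα0 hα1 hV0 hV1 hm hL]
  have hmem := fun ω k => postVar_mem hα0 hα1.le hV0 hV1 (hL ω) k
  constructor
  · exact mul_nonneg (by positivity) (Finset.sum_nonneg fun k _ =>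
      integral_nonneg fun ω => (hmem ω k).1)
  · refine average_le (fun k => ?_) T
    calc ∫ ω, postVar α V0 (L ω) k ∂μ ≤ ∫ _, 1 ∂μ :=
          integral_mono (integrable_postVar hα0 hα1 hV0 hV1 hm hL k) (integrable_const _)
            fun ω => (hmem ω k).2
      _ = 1 := by simp

include hBN hSA

/-- The expected gap in a single slot. -/
lemma integral_gap_mem (hΓ : ∀ g ∈ Γ, 0 ≤ g ∧ g ≤ 1) (hπ : π.bind P = π) (hρ : IsRankingRule ρ)
    (k : ℕ) :
    0 ≤ ∫ ω, postVar α V0 (scdpSNR SA ω) k - postVar α V0 (fun k => bestSNR SA (ω.1 k).2) k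
        ∂jointLaw α SA V0 (δ.toPolicy N) π P ρ ∧
    ∫ ω, postVar α V0 (scdpSNR SA ω) k - postVar α V0 (fun k => bestSNR SA (ω.1 k).2) k
        ∂jointLaw α SA V0 (δ.toPolicy N) π P ρ ≤
      1 / (1 - α) * (Measure.pi fun _ : Fin N => π.toMeasure).real {γ | numBest γ < B} := by
  set μ := jointLaw α SA V0 (δ.toPolicy N) π P ρ with hμ
  set q := (Measure.pi fun _ : Fin N => π.toMeasure).real {γ | numBest γ < B} with hq
  set L' : JointPath N B Γ → ℕ → ℝ := scdpSNR SA with hL'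
  set L : JointPath N B Γ → ℕ → ℝ := fun ω k => bestSNR SA (ω.1 k).2 with hL
  let b : ℕ → JointPath N B Γ → ℝ := fun k =>
    Set.indicator {ω | numBest (ω.2 k).1 < B} (fun _ => (1 : ℝ))
  have hle : ∀ᵐ ω ∂μ, ∀ k, L' ω k ≤ L ω k := ae_scdpSNR_le δ hBN hSA hΓ
  have hL0 : ∀ ω k, 0 ≤ L' ω k := scdpSNR_nonneg hSA
  have heq : ∀ k, ∀ᵐ ω ∂μ, b k ω < 1 → L' ω k = L ω k := fun k => by
    filter_upwards [ae_scdpSNR_eq (SA := SA) (α := α) (V0 := V0) δ hBN hΓ hπ hρ k] with ω hω hb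
    refine hω (not_lt.1 fun h => ?_)
    have : b k ω = 1 := Set.indicator_of_mem (s := {ω : JointPath N B Γ | numBest (ω.2 k).1 < B}) h _
    linarith
  have hb0 : ∀ k ω, 0 ≤ b k ω := fun k ω => Set.indicator_nonneg (fun _ _ => zero_le_one) ω
  have hset : MeasurableSet {γ : Fin N → Γ | numBest γ < B} := (Set.to_countable _).measurableSet
  have hγ : ∀ k, Measurable fun ω : JointPath N B Γ => (ω.2 k).1 := fun k => by fun_prop
  have hbi : ∀ k, Integrable (b k) μ := fun k =>
    (integrable_const (1 : ℝ)).indicator (hγ k hset)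
  -- The accuracy states are stationary, so a bad slot has the same probability for every `k`.
  have hbq : ∀ k, ∫ ω, b k ω ∂μ = q := fun k => by
    have hmap : μ.map (fun ω => (ω.2 k).1) = Measure.pi fun _ : Fin N => π.toMeasure := by
      rw [← map_accuracy_sensorLaw hπ ρ k]
      have hmp : MeasurePreserving Prod.snd μ (sensorLaw π P ρ) := measurePreserving_snd
      rw [← hmp.map_eq, Measure.map_map (by fun_prop) (by fun_prop)]
      rfl
    rw [hq, ← hmap, map_measureReal_apply (hγ k) hset]
    exact integral_indicator_one (hγ k hset)
  have hi' : ∀ k, Integrable (fun ω => postVar α V0 (L' ω) k) μ :=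
    integrable_postVar hα0 hα1 hV0 hV1 (measurable_scdpSNR SA) hL0
  have hi : ∀ k, Integrable (fun ω => postVar α V0 (L ω) k) μ :=
    integrable_postVar hα0 hα1 hV0 hV1 measurable_bestSNR_fst fun ω k =>
      aggSNR_nonneg hSA _ _
  have hq0 : 0 ≤ q := measureReal_nonneg
  have h1α : 0 < 1 - α := by linarith
  constructor
  · refine integral_nonneg_of_ae ?_
    filter_upwards [hle] with ω hω
    exact sub_nonneg.2 (postVar_le hα0 hα1.le hV0 hV1 (hL0 ω) hω k)
  · induction k with
    | zero =>
      calc ∫ ω, postVar α V0 (L' ω) 0 - postVar α V0 (L ω) 0 ∂μ ≤ ∫ ω, b 0 ω ∂μ := by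
            refine integral_mono_ae ((hi' 0).sub (hi 0)) (hbi 0) ?_
            filter_upwards [hle, heq 0] with ω hω he
            exact postVar_zero_sub_le hα0 hα1.le hV0 hV1 (hL0 ω) hω (hb0 0 ω) he
        _ = q := hbq 0
        _ ≤ 1 / (1 - α) * q := le_mul_of_one_le_left hq0 (by
            rw [le_div_iff₀ h1α]; linarith)
    | succ k ih =>
      calc ∫ ω, postVar α V0 (L' ω) (k + 1) - postVar α V0 (L ω) (k + 1) ∂μ
          ≤ ∫ ω, α * (postVar α V0 (L' ω) k - postVar α V0 (L ω) k) + b (k + 1) ω ∂μ := by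
            refine integral_mono_ae ((hi' _).sub (hi _))
              ((((hi' k).sub (hi k)).const_mul α).add (hbi _)) ?_
            filter_upwards [hle, heq (k + 1)] with ω hω he
            exact postVar_succ_sub_le hα0 hα1.le hV0 hV1 (hL0 ω) hω k (hb0 _ ω) he
        _ = α * ∫ ω, postVar α V0 (L' ω) k - postVar α V0 (L ω) k ∂μ + q := by
            rw [← hbq (k + 1), ← integral_const_mul]
            exact integral_add (((hi' k).sub (hi k)).const_mul α) (hbi _)
        _ ≤ α * (1 / (1 - α) * q) + q := by gcongr
        -- `q / (1 - α)` is the fixed point of `x ↦ α * x + q`.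
        _ = 1 / (1 - α) * q := by field_simp; ring

lemma scdpMSE_sub_bestMSE_mem (hΓ : ∀ g ∈ Γ, 0 ≤ g ∧ g ≤ 1) (hπ : π.bind P = π)
    (hρ : IsRankingRule ρ) (T : ℕ) :
    0 ≤ scdpMSE α SA V0 (δ.toPolicy N) π P ρ T - bestMSE α SA V0 (δ.toPolicy N) T ∧
    scdpMSE α SA V0 (δ.toPolicy N) π P ρ T - bestMSE α SA V0 (δ.toPolicy N) T ≤
      1 / (1 - α) * (Measure.pi fun _ : Fin N => π.toMeasure).real {γ | numBest γ < B} := by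
  have hi' := integrable_postVar (μ := jointLaw α SA V0 (δ.toPolicy N) π P ρ) hα0 hα1 hV0 hV1
    (measurable_scdpSNR SA) (scdpSNR_nonneg hSA)
  have hi := integrable_postVar (μ := jointLaw α SA V0 (δ.toPolicy N) π P ρ) hα0 hα1 hV0 hV1
    (L := fun ω k => bestSNR SA (ω.1 k).2) measurable_bestSNR_fst fun ω k => aggSNR_nonneg hSA _ _
  have hgap := integral_gap_mem (P := P) (ρ := ρ) δ hBN hα0 hα1 hSA hV0 hV1 hΓ hπ hρ
  rw [bestMSE_eq_avgMSE _ π P ρ, scdpMSE,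
    avgMSE_eq hα0 hα1 hV0 hV1 (measurable_scdpSNR SA) (scdpSNR_nonneg hSA),
    avgMSE_eq hα0 hα1 hV0 hV1 measurable_bestSNR_fst fun ω k => aggSNR_nonneg hSA _ _,
    ← mul_sub, ← Finset.sum_sub_distrib,
    Finset.sum_congr rfl fun k _ => (integral_sub (hi' k) (hi k)).symm]
  exact ⟨mul_nonneg (by positivity) (Finset.sum_nonneg fun k _ => (hgap k).1),
    average_le (fun k => (hgap k).2) T⟩

end MSE

/-! ### Horizons -/

lemma atHorizon_sub_mem {a b : ℕ → ℝ} {C : ℝ} (ha : ∀ T, 0 ≤ a T ∧ a T ≤ 1)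
    (hb : ∀ T, 0 ≤ b T ∧ b T ≤ 1) (hab : ∀ T, 0 ≤ a T - b T ∧ a T - b T ≤ C) (h : ℕ∞) :
    0 ≤ atHorizon h a - atHorizon h b ∧ atHorizon h a - atHorizon h b ≤ C := by
  cases h with
  | coe T => exact hab T
  | top =>
    change 0 ≤ limsup a atTop - limsup b atTop ∧ limsup a atTop - limsup b atTop ≤ C
    -- On `ℝ` the `limsup` is monotone and commutes with adding a constant only under boundedness,
    -- which the range `[0, 1]` supplies.
    have hbdd : ∀ {f : ℕ → ℝ}, (∀ T, 0 ≤ f T ∧ f T ≤ 1) →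
        IsBoundedUnder (· ≤ ·) atTop f ∧ IsCoboundedUnder (· ≤ ·) atTop f := fun hf =>
      ⟨isBoundedUnder_of ⟨1, fun T => (hf T).2⟩,
        (isBoundedUnder_of ⟨0, fun T => (hf T).1⟩ : IsBoundedUnder (· ≥ ·) atTop _).isCoboundedUnder_le⟩
    have hC : 0 ≤ C := (hab 0).1.trans (hab 0).2
    have hadd : limsup (fun T => b T + C) atTop = limsup b atTop + C :=
      limsup_add_const atTop b C (hbdd hb).1 (hbdd hb).2
    constructor
    · refine sub_nonneg.2 (limsup_le_limsup (Eventually.of_forall fun T => ?_) (hbdd hb).2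
        (hbdd ha).1)
      have := (hab T).1
      linarith
    · rw [sub_le_iff_le_add', ← hadd]
      refine limsup_le_limsup (Eventually.of_forall fun T => ?_) (hbdd ha).2
        (isBoundedUnder_of ⟨1 + C, fun T => by have := (hb T).2; linarith⟩)
      have := (hab T).2
      simp only
      linarith

end WSN

end

theorem mainTheorem2
    -- network size, number of channels, and model parameters
    (N B : ℕ) (hB : 1 ≤ B) (hBN : B ≤ N)
    (α SA V0 cTX φ : ℝ) (hα0 : 0 ≤ α) (hα1 : α < 1) (hSA : 0 < SA)
    (hV0 : 0 ≤ V0) (hV1 : V0 ≤ 1) (hc : 0 < cTX) (hφ : 0 ≤ φ)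
    -- accuracy states: finite set with maximum `1`, transition probabilities, steady state
    (Γ : Finset ℝ) (h1 : (1 : ℝ) ∈ Γ) (hΓ : ∀ g ∈ Γ, 0 ≤ g ∧ g ≤ 1)
    (P : Γ → PMF Γ) (π : PMF Γ) (hπ : π.bind P = π)
    (p : ℝ) (hp : p = (π ⟨1, h1⟩).toReal) (hp0 : 0 < p)
    (hN : ((B : ℝ) - 1) / p ≤ (N : ℝ))
    -- horizon, finite or infinite, and an optimal policy for the best accuracy states
    (h : ℕ∞) (δ : WSN.Rule B)
    (hδ : (∃ ε : ℝ, 0 < ε ∧ WSN.SolvesConstrained α SA V0 cTX φ ε h (δ.toPolicy N)) ∨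
      (∃ lam : ℝ, 0 < lam ∧ WSN.SolvesLagrangian α SA V0 cTX φ lam h (δ.toPolicy N))) :
    -- each node has the same cost, when ties in the ranking are broken uniformly
    (∀ n : Fin N,
      WSN.atHorizon h
          (WSN.scdpCost α SA V0 cTX φ (δ.toPolicy N) π P WSN.uniformRanking n) =
        WSN.atHorizon h (WSN.bestCost α SA V0 cTX φ (δ.toPolicy N) n)) ∧
    -- network cost and MSE gap, for every tie-breaking rule
    ∀ ρ : (Fin N → Γ) → PMF (Equiv.Perm (Fin N)), WSN.IsRankingRule ρ →
      WSN.atHorizon h (fun T => ∑ n, WSN.scdpCost α SA V0 cTX φ (δ.toPolicy N) π P ρ n T) =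
        WSN.atHorizon h (fun T => ∑ n, WSN.bestCost α SA V0 cTX φ (δ.toPolicy N) n T) ∧
      0 ≤ WSN.atHorizon h (WSN.scdpMSE α SA V0 (δ.toPolicy N) π P ρ) -
          WSN.atHorizon h (WSN.bestMSE α SA V0 (δ.toPolicy N)) ∧
      WSN.atHorizon h (WSN.scdpMSE α SA V0 (δ.toPolicy N) π P ρ) -
          WSN.atHorizon h (WSN.bestMSE α SA V0 (δ.toPolicy N)) ≤
        1 / (1 - α) * Real.exp (-((N * p - B + 1) ^ 2 / (2 * (N * p)))) ∧
      WSN.atHorizon h (WSN.scdpMSE α SA V0 (δ.toPolicy N) π P ρ) -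
          WSN.atHorizon h (WSN.bestMSE α SA V0 (δ.toPolicy N)) ≤
        Real.exp ((B : ℝ) - 1) / (1 - α) * Real.exp (-(N * p / 2)) := by
  have hN0 : 0 < N := hB.trans hBN
  have hx : 0 < (N : ℝ) * p := by positivity
  refine ⟨fun n => ?_, fun ρ hρ => ?_⟩
  · exact congrArg _ (funext fun T =>
      WSN.scdpCost_eq_bestCost α SA V0 δ π P hBN hc.le hφ hπ n T)
  have hgap := WSN.scdpMSE_sub_bestMSE_mem (P := P) (ρ := ρ) δ hBN hα0 hα1 hSA hV0 hV1 hΓ hπ hρ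
  have hscdp : ∀ T, 0 ≤ WSN.scdpMSE α SA V0 (δ.toPolicy N) π P ρ T ∧
      WSN.scdpMSE α SA V0 (δ.toPolicy N) π P ρ T ≤ 1 :=
    WSN.avgMSE_mem hα0 hα1 hV0 hV1 (WSN.measurable_scdpSNR SA) (WSN.scdpSNR_nonneg hSA)
  have hbest : ∀ T, 0 ≤ WSN.bestMSE α SA V0 (δ.toPolicy N) T ∧
      WSN.bestMSE α SA V0 (δ.toPolicy N) T ≤ 1 := fun T => by
    rw [WSN.bestMSE_eq_avgMSE _ π P ρ]
    exact WSN.avgMSE_mem hα0 hα1 hV0 hV1 WSN.measurable_bestSNR_fst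
      (fun ω k => WSN.aggSNR_nonneg hSA _ _) T
  have hmem := WSN.atHorizon_sub_mem hscdp hbest hgap h
  have h1α : 0 ≤ 1 / (1 - α) := by
    have : 0 < 1 - α := by linarith
    positivity
  have hbound := hmem.2.trans (mul_le_mul_of_nonneg_left
    (WSN.measureReal_numBest_lt_le h1 π hp hp0 hN hN0) h1α)
  refine ⟨congrArg _ (funext fun T => WSN.sum_scdpCost_eq α SA V0 δ π P ρ hBN hc.le hφ T),
    hmem.1, hbound, hbound.trans ?_⟩
  refine (mul_le_mul_of_nonneg_left (WSN.exp_deviation_le hx) h1α).trans (le_of_eq ?_)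
  ring
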